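/- Let $k\ge 2$, let $T$ be the shift on the space $\{1,\dots,k\}^{\mathbb Z}$ of bi-infinite words, $(T\omega)_i=\omega_{i+1}$, with the product topology. For $\mathsf A=(A_1,\dots,A_k)\in \mathrm{SL}(2,\mathbb R)^k$ put $A^{(n)}(\omega)=A_{\omega_{n-1}}\cdots A_{\omega_0}$ for $n\ge 0$ and $A^{(-n)}(\omega)=\big(A^{(n)}(T^{-n}\omega)\big)^{-1}$ for $n\ge 1$, and let $\|\cdot\|$ be the Euclidean operator norm. The one-step cocycle generated by $\mathsf A$ is called uniformly hyperbolic if for every $\omega$ there is a splitting $\mathbb R^2=E^u(\omega)\oplus E^s(\omega)$ into lines with $A_{\omega_0}E^{*}(\omega)=E^{*}(T\omega)$ for $*\in\{u,s\}$, and there are constants $c,C,\delta>0$ such that, for all $\omega$ and all $n\ge 0$, $\|A^{(n)}(\omega)v\|\ge c\,e^{\delta n}\|v\|$ for $v\in E^u(\omega)$ and $\|A^{(n)}(\omega)v\|\le C e^{-\delta n}\|v\|$ for $v\in E^s(\omega)$. Theorem C. There exists an open and dense subset $\mathcal U$ of $\mathrm{SL}(2,\mathbb R)^k$ such that for every $\mathsf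 A\in\mathcal U$ exactly one of the following holds: 1. the one-step cocycle over $T$ generated by $\mathsf A$ is uniformly hyperbolic; 2. there exists a compact set $K\subset\{1,\dots,k\}^{\mathbb Z}$ with $T(K)=K$, of positive topological entropy, such that the norms $\|A^{(n)}(\omega)\|$ are uniformly bounded over $(\omega,n)\in K\times\mathbb Z$. Moreover, in the second case there exists a $T$-invariant Borel probability measure $\mu$ on $\{1,\dots,k\}^{\mathbb Z}$ with metric entropy $h_\mu(T)>0$ and $\lambda_1(\mathsf A,\mu)=0$, where $\lambda_1(\mathsf A,\mu)=\int \lim_{n\to+\infty}\frac1n\log\|A^{(n)}(\omega)\|\,d\mu(\omega)$ (the limit exists for $\mu$-almost every $\omega$). -/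

import Mathlib

open Filter Topology MeasureTheory
open scoped MatrixGroups

noncomputable section

namespace OneStep

/-- The space of bi-infinite words on `k` symbols, with the product topology and the
product (Borel) σ-algebra of the discrete structures on `Fin k`. -/
abbrev Word (k : ℕ) : Type := ℤ → Fin k

/-- The `m`-th power (`m : ℤ`) of the shift: `(T^m ω)_i = ω_{i+m}`. -/
def shiftPow {k : ℕ} (m : ℤ) (ω : Word k) : Word k := fun i => ω (i + m)

/-- The full shift `T`. -/
def shift {k : ℕ} : Word k → Word k := shiftPow 1

/-- `A^{(n)}(ω) = A_{ω_{n-1}} ⋯ A_{ω_0}` for `n ≥ 0`. -/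
def prodNat {k : ℕ} (A : Fin k → SL(2, ℝ)) : ℕ → Word k → SL(2, ℝ)
  | 0, _ => 1
  | n + 1, ω => A (ω n) * prodNat A n ω

/-- `A^{(n)}(ω)` for `n ∈ ℤ`, where `A^{(-n)}(ω) = (A^{(n)}(T^{-n} ω))⁻¹` for `n ≥ 1`. -/
def prodInt {k : ℕ} (A : Fin k → SL(2, ℝ)) : ℤ → Word k → SL(2, ℝ)
  | Int.ofNat n, ω => prodNat A n ω
  | Int.negSucc n, ω => (prodNat A (n + 1) (shiftPow (Int.negSucc n) ω))⁻¹

/-- The linear action of `M ∈ SL(2, ℝ)` on the Euclidean plane. -/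
def act (M : SL(2, ℝ)) : EuclideanSpace ℝ (Fin 2) →L[ℝ] EuclideanSpace ℝ (Fin 2) :=
  Matrix.toEuclideanCLM (n := Fin 2) (𝕜 := ℝ) (M : Matrix (Fin 2) (Fin 2) ℝ)

/-- The Euclidean operator norm of `M ∈ SL(2, ℝ)`. -/
def opNorm (M : SL(2, ℝ)) : ℝ := ‖act M‖

/-- Uniform hyperbolicity of the one-step cocycle generated by `A`: there is an equivariant
splitting of the plane into two lines over each point, `Eu` uniformly expanded and `Es`
uniformly contracted. -/
def UniformlyHyperbolic {k : ℕ} (A : Fin k → SL(2, ℝ)) : Prop :=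
  ∃ Eu Es : Word k → Submodule ℝ (EuclideanSpace ℝ (Fin 2)),
    (∀ ω, Module.finrank ℝ (Eu ω) = 1 ∧ Module.finrank ℝ (Es ω) = 1 ∧ IsCompl (Eu ω) (Es ω)) ∧
    (∀ ω, (Eu ω).map (act (A (ω 0))).toLinearMap = Eu (shift ω) ∧
      (Es ω).map (act (A (ω 0))).toLinearMap = Es (shift ω)) ∧
    ∃ c C δ : ℝ, 0 < c ∧ 0 < C ∧ 0 < δ ∧ ∀ (ω : Word k) (n : ℕ),
      (∀ v ∈ Eu ω, c * Real.exp (δ * n) * ‖v‖ ≤ ‖act (prodNat A n ω) v‖) ∧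
      (∀ v ∈ Es ω, ‖act (prodNat A n ω) v‖ ≤ C * Real.exp (-(δ * n)) * ‖v‖)

/-- The topological entropy of the shift on `K`, with respect to the product of the discrete
uniformities, which induces the topology of `Word k`. -/
def topologicalEntropy {k : ℕ} (K : Set (Word k)) : EReal :=
  letI : UniformSpace (Word k) := @Pi.uniformSpace ℤ (fun _ => Fin k) (fun _ => ⊥)
  Dynamics.coverEntropy shift K

/-- There is a compact shift-invariant set of positive topological entropy on which the norms
of all products, forward and backward in time, are uniformly bounded. -/
def HasBoundedSetOfPositiveEntropy {k : ℕ} (A : Fin k → SL(2, ℝ)) : Prop :=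
  ∃ K : Set (Word k), IsCompact K ∧ shift '' K = K ∧
    0 < topologicalEntropy K ∧
    ∃ C : ℝ, ∀ ω ∈ K, ∀ n : ℤ, opNorm (prodInt A n ω) ≤ C

/-- The `n`-itinerary of `x` under `T` with respect to the finite partition into the level
sets of `f`. -/
def itinerary {X : Type*} (T : X → X) {m : ℕ} (f : X → Fin m) (n : ℕ) (x : X) : Fin n → Fin m :=
  fun j => f (T^[j] x)

/-- The Shannon entropy of the join of the pullbacks by `T^j`, `j < n`, of the partition into
the level sets of `f`. -/
def joinEntropy {X : Type*} [MeasurableSpace X] (μ : Measure X) (T : X → X)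
    {m : ℕ} (f : X → Fin m) (n : ℕ) : ℝ :=
  ∑ w : Fin n → Fin m, Real.negMulLog (μ.real (itinerary T f n ⁻¹' {w}))

/-- The Kolmogorov–Sinai entropy `h_μ(T)`: the supremum over finite measurable partitions of
the entropy of `T` relative to the partition. (For an invariant probability measure the limsup
is a limit.) -/
def metricEntropy {X : Type*} [MeasurableSpace X] (μ : Measure X) (T : X → X) : EReal :=
  ⨆ (m : ℕ) (f : X → Fin m) (_ : Measurable f),
    limsup (fun n : ℕ => ((joinEntropy μ T f n / n : ℝ) : EReal)) atTop

/-- `λ₁(A, μ) = c`: the top Lyapunov exponent `λ₁(A, ω) = lim (1/n) log ‖A^{(n)}(ω)‖` exists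
for `μ`-almost every `ω`, and its integral is `c`. -/
def HasTopExponent {k : ℕ} (A : Fin k → SL(2, ℝ)) (μ : Measure (Word k)) (c : ℝ) : Prop :=
  ∃ lam : Word k → ℝ, Integrable lam μ ∧
    (∀ᵐ ω ∂μ, Tendsto (fun n : ℕ => (1 / (n : ℝ)) * Real.log (opNorm (prodNat A n ω)))
      atTop (𝓝 (lam ω))) ∧
    ∫ ω, lam ω ∂μ = c

end OneStep

end

/-!
The open dense set is the union of the complement of the closure of the families with an elliptic
product and of the set of *steerable* families.

**Away from elliptic products the cocycle is uniformly hyperbolic.** Follow every generator by the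
rotation by `arctan x`. Up to the factor `(1 + x²)^(n/2)`, the trace of a product of `n` of these
matrices is the value at `x` of a polynomial `p`, and `p` has no root in `ℂ ∖ ℝ`: at a nonreal
parameter the products expand an indefinite Hermitian form more than their determinants allow for a
matrix of trace zero (`trace_tiltProd_ne_zero`). If no product is elliptic for `|x| ≤ τ`, the roots
are moreover at distance at least `τ` from `0`, so that `|p 0|² ≥ |p τ| |p (-τ)|`, and the trace of
the original product has modulus at least `2 (1 + τ²)^(n/2)` (`abs_tr_wordProd_ge`). Such a uniform
growth of traces yields the hyperbolic splitting (`TraceGrowth.uniformlyHyperbolic`): the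
contracting eigendirections of the products along a word converge exponentially fast, because area
is preserved, which allows comparing any word with periodic ones.

**Families with an elliptic product are approximated by steerable ones.** After a small rotation of
the generators the traces of all products avoid the countably many values `2 cos (π r)` with `r`
rational. An elliptic product is then an irrational rotation about a point of the hyperbolic plane,
and, after a further perturbation if necessary, some product of the same length moves this point.
Rotating by a suitable angle before applying the latter pulls distant points back, so that from a
compact set of matrices, after a free choice between the two products, one can always return to the
interior of this set in a fixed number of steps (`steerable_of_conj_rot`). This property is open.

**Steerable families have bounded products with positive entropy.** Making the free choices at
random gives a random word with bounded products, with exponentially small probabilities of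
cylinders (`Steerable.exists_measure`). Both properties pass to an invariant measure by averaging
along the orbit (`Steerable.exists_invariant_measure`); this measure has positive entropy and
vanishing exponent, and so many words are needed to carry its mass that the compact set of words
with bounded products has positive topological entropy.
-/

namespace OneStep

/-! ### Plane linear algebra -/

/-- The area form `x ∧ y` on the Euclidean plane. -/
def wedge (x y : EuclideanSpace ℝ (Fin 2)) : ℝ := x 0 * y 1 - x 1 * y 0

/-- Rotation of the Euclidean plane by a right angle. -/
def quarterTurn (x : EuclideanSpace ℝ (Fin 2)) : EuclideanSpace ℝ (Fin 2) := !₂[-x 1, x 0]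

lemma act_apply (M : SL(2, ℝ)) (v : EuclideanSpace ℝ (Fin 2)) :
    act M v = !₂[M 0 0 * v 0 + M 0 1 * v 1, M 1 0 * v 0 + M 1 1 * v 1] := by
  ext i
  rw [act, Matrix.ofLp_toEuclideanCLM]
  fin_cases i <;> simp [Matrix.mulVec, dotProduct, Fin.sum_univ_two]

@[simp] lemma act_apply_zero (M : SL(2, ℝ)) (v : EuclideanSpace ℝ (Fin 2)) :
    act M v 0 = M 0 0 * v 0 + M 0 1 * v 1 := by simp [act_apply]

@[simp] lemma act_apply_one (M : SL(2, ℝ)) (v : EuclideanSpace ℝ (Fin 2)) :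
    act M v 1 = M 1 0 * v 0 + M 1 1 * v 1 := by simp [act_apply]

lemma act_mul (M N : SL(2, ℝ)) (v : EuclideanSpace ℝ (Fin 2)) :
    act (M * N) v = act M (act N v) := by
  simp [act]

@[simp] lemma act_one (v : EuclideanSpace ℝ (Fin 2)) : act 1 v = v := by
  simp [act]

@[simp] lemma act_inv_act (M : SL(2, ℝ)) (v : EuclideanSpace ℝ (Fin 2)) :
    act M⁻¹ (act M v) = v := by
  rw [← act_mul]; simp

@[simp] lemma act_act_inv (M : SL(2, ℝ)) (v : EuclideanSpace ℝ (Fin 2)) :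
    act M (act M⁻¹ v) = v := by
  rw [← act_mul]; simp

lemma det_eq_one (M : SL(2, ℝ)) : M 0 0 * M 1 1 - M 0 1 * M 1 0 = 1 := by
  have := M.det_coe
  rwa [Matrix.det_fin_two] at this

lemma norm_sq_eq (v : EuclideanSpace ℝ (Fin 2)) : ‖v‖ ^ 2 = v 0 ^ 2 + v 1 ^ 2 := by
  rw [EuclideanSpace.norm_sq_eq]; simp [Fin.sum_univ_two]

@[simp] lemma norm_quarterTurn (v : EuclideanSpace ℝ (Fin 2)) : ‖quarterTurn v‖ = ‖v‖ := by
  rw [← sq_eq_sq₀ (norm_nonneg _) (norm_nonneg _), norm_sq_eq, norm_sq_eq]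
  simp [quarterTurn]; ring

lemma wedge_quarterTurn (v : EuclideanSpace ℝ (Fin 2)) : wedge v (quarterTurn v) = ‖v‖ ^ 2 := by
  rw [norm_sq_eq]; simp [wedge, quarterTurn]; ring

lemma wedge_act (M : SL(2, ℝ)) (x y : EuclideanSpace ℝ (Fin 2)) :
    wedge (act M x) (act M y) = wedge x y := by
  simp only [wedge, act_apply_zero, act_apply_one]
  linear_combination (x 0 * y 1 - x 1 * y 0) * det_eq_one M

lemma abs_wedge_le (x y : EuclideanSpace ℝ (Fin 2)) : |wedge x y| ≤ ‖x‖ * ‖y‖ := by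
  apply abs_le_of_sq_le_sq _ (by positivity)
  rw [mul_pow, norm_sq_eq, norm_sq_eq, wedge]
  nlinarith [sq_nonneg (x 0 * y 0 + x 1 * y 1)]

lemma norm_act_le (M : SL(2, ℝ)) (v : EuclideanSpace ℝ (Fin 2)) :
    ‖act M v‖ ≤ opNorm M * ‖v‖ := (act M).le_opNorm v

lemma opNorm_nonneg (M : SL(2, ℝ)) : 0 ≤ opNorm M := norm_nonneg _

/-- The inverse of a unimodular matrix of the plane is bounded by the norm of the matrix: this is
the invariance of area, applied to a vector and its quarter turn. -/
lemma norm_act_inv_le (M : SL(2, ℝ)) (v : EuclideanSpace ℝ (Fin 2)) :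
    ‖act M⁻¹ v‖ ≤ opNorm M * ‖v‖ := by
  set w := act M⁻¹ v with hw
  have h1 : ‖w‖ ^ 2 ≤ ‖v‖ * (opNorm M * ‖w‖) := by
    rw [← wedge_quarterTurn, ← wedge_act M, hw, act_act_inv, ← hw]
    refine (le_abs_self _).trans ((abs_wedge_le _ _).trans ?_)
    gcongr
    simpa using norm_act_le M (quarterTurn w)
  rcases (norm_nonneg w).eq_or_lt with h | h
  · rw [← h]; exact mul_nonneg (opNorm_nonneg _) (norm_nonneg _)
  · nlinarith

lemma opNorm_inv (M : SL(2, ℝ)) : opNorm M⁻¹ = opNorm M := by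
  have key : ∀ N : SL(2, ℝ), opNorm N⁻¹ ≤ opNorm N := fun N =>
    (act N⁻¹).opNorm_le_bound (opNorm_nonneg N) (norm_act_inv_le N)
  exact le_antisymm (key M) (by simpa using key M⁻¹)

lemma norm_le_opNorm_mul_norm_act (M : SL(2, ℝ)) (v : EuclideanSpace ℝ (Fin 2)) :
    ‖v‖ ≤ opNorm M * ‖act M v‖ := by
  simpa using norm_act_inv_le M (act M v)

lemma opNorm_mul_le (M N : SL(2, ℝ)) : opNorm (M * N) ≤ opNorm M * opNorm N := by
  refine (act (M * N)).opNorm_le_bound (mul_nonneg (opNorm_nonneg M) (opNorm_nonneg N)) fun v => ?_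
  rw [act_mul, mul_assoc]
  exact (norm_act_le _ _).trans (mul_le_mul_of_nonneg_left (norm_act_le _ _) (opNorm_nonneg _))

lemma one_le_opNorm (M : SL(2, ℝ)) : 1 ≤ opNorm M := by
  have h := norm_le_opNorm_mul_norm_act M (EuclideanSpace.single 0 1)
  have h2 := norm_act_le M (EuclideanSpace.single 0 1)
  have h3 := opNorm_nonneg M
  simp only [PiLp.norm_single, norm_one, mul_one] at h h2
  nlinarith

/-- The trace of a unimodular matrix. -/
def tr (M : SL(2, ℝ)) : ℝ := M 0 0 + M 1 1

lemma tr_inv (M : SL(2, ℝ)) : tr M⁻¹ = tr M := by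
  simp [tr, Matrix.SpecialLinearGroup.SL2_inv_expl, add_comm]

lemma tr_mul_comm (M N : SL(2, ℝ)) : tr (M * N) = tr (N * M) := by
  simp [tr, Matrix.mul_apply, Fin.sum_univ_two]; ring

lemma continuous_coe_apply (i j : Fin 2) : Continuous fun M : SL(2, ℝ) => M i j :=
  (continuous_id.matrix_elem i j).comp Matrix.SpecialLinearGroup.isClosedEmbedding_val.continuous

lemma continuous_tr : Continuous tr :=
  (continuous_coe_apply 0 0).add (continuous_coe_apply 1 1)

/-- A unimodular matrix with real spectrum has a real eigenvector whose eigenvalue is the smaller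
one in modulus. -/
lemma exists_contracted_eigenvector (M : SL(2, ℝ)) {t : ℝ} (ht : 1 ≤ t) (h : 2 * t ≤ |tr M|) :
    ∃ v : EuclideanSpace ℝ (Fin 2), ‖v‖ = 1 ∧ ∃ c : ℝ, |c| ≤ t⁻¹ ∧ act M v = c • v := by
  set T := tr M with hT
  have hs : Real.sqrt (T ^ 2 - 4) ^ 2 = T ^ 2 - 4 := by
    refine Real.sq_sqrt ?_
    rw [← sq_abs]; nlinarith
  have hs0 := Real.sqrt_nonneg (T ^ 2 - 4)
  set s := Real.sqrt (T ^ 2 - 4)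
  set r := (|T| + s) / 2 with hr
  have hrt : t ≤ r := by rw [hr]; linarith
  have hr0 : 0 < r := by linarith
  have hquad : r ^ 2 - |T| * r + 1 = 0 := by
    rw [hr]; nlinarith [sq_abs T]
  have hT0 : |T| ≠ 0 := by intro h0; rw [h0] at h; linarith
  -- The eigenvalue is `± r⁻¹` with the sign of the trace.
  set c := T / |T| * r⁻¹ with hc
  have habs : |c| = r⁻¹ := by
    rw [hc, abs_mul, abs_div, abs_abs, div_self hT0, one_mul, abs_inv, abs_of_pos hr0]
  have hcT : T * c = |T| * r⁻¹ := by
    rw [hc]; field_simp; rw [sq_abs]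
  have hchar : c ^ 2 - T * c + 1 = 0 := by
    rw [← sq_abs c, habs, hcT]; field_simp; linarith
  have hdet : ((M : Matrix (Fin 2) (Fin 2) ℝ) - Matrix.scalar (Fin 2) c).det = 0 := by
    rw [Matrix.det_fin_two]
    simp
    rw [hT, tr] at hchar
    linear_combination hchar + det_eq_one M
  obtain ⟨w, hw0, hw⟩ := Matrix.exists_mulVec_eq_zero_iff.mpr hdet
  have e0 := congrFun hw 0
  have e1 := congrFun hw 1
  simp [Matrix.mulVec, dotProduct, Fin.sum_univ_two] at e0 e1
  set v : EuclideanSpace ℝ (Fin 2) := WithLp.toLp 2 w with hv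
  have hv0 : v ≠ 0 := by
    simpa [hv] using hw0
  have hev : act M v = c • v := by
    ext i; fin_cases i
    · simp [hv]; linarith
    · simp [hv]; linarith
  refine ⟨‖v‖⁻¹ • v, ?_, c, ?_, ?_⟩
  · rw [norm_smul, norm_inv, norm_norm, inv_mul_cancel₀ (norm_ne_zero_iff.mpr hv0)]
  · rw [habs]; exact inv_anti₀ (by linarith) hrt
  · rw [map_smul, hev, smul_comm]

/-! ### Products along words -/

lemma shiftPow_apply {k : ℕ} (m : ℤ) (ω : Word k) (i : ℤ) : shiftPow m ω i = ω (i + m) := rfl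

lemma shiftPow_add {k : ℕ} (m n : ℤ) (ω : Word k) :
    shiftPow (m + n) ω = shiftPow m (shiftPow n ω) := by
  funext i; simp [shiftPow, add_assoc]

@[simp] lemma shiftPow_zero {k : ℕ} (ω : Word k) : shiftPow 0 ω = ω := by
  funext i; simp [shiftPow]

lemma shift_iterate {k : ℕ} (n : ℕ) (ω : Word k) : shift^[n] ω = shiftPow n ω := by
  induction n with
  | zero => simp
  | succ n ih =>
    rw [Function.iterate_succ_apply', ih, shift, ← shiftPow_add]; congr 1; push_cast; ring

lemma prodNat_congr {k : ℕ} (A : Fin k → SL(2, ℝ)) {n : ℕ} {ω η : Word k}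
    (h : ∀ i < n, ω (i : ℕ) = η (i : ℕ)) : prodNat A n ω = prodNat A n η := by
  induction n with
  | zero => rfl
  | succ n ih =>
    simp only [prodNat]
    rw [ih fun i hi => h i (by omega), h n (by omega)]

lemma prodNat_add {k : ℕ} (A : Fin k → SL(2, ℝ)) (m n : ℕ) (ω : Word k) :
    prodNat A (m + n) ω = prodNat A m (shiftPow n ω) * prodNat A n ω := by
  induction m with
  | zero => simp [prodNat]
  | succ m ih =>
    rw [show m + 1 + n = (m + n) + 1 by ring]
    simp only [prodNat, ih, shiftPow_apply, mul_assoc]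
    push_cast; rfl

lemma prodNat_succ' {k : ℕ} (A : Fin k → SL(2, ℝ)) (n : ℕ) (ω : Word k) :
    prodNat A (n + 1) ω = prodNat A n (shift ω) * A (ω 0) := by
  rw [prodNat_add]; simp [prodNat, shift]

/-- The product along a finite word, the first letter acting first. -/
def wordProd {k : ℕ} (A : Fin k → SL(2, ℝ)) : List (Fin k) → SL(2, ℝ)
  | [] => 1
  | i :: l => wordProd A l * A i

lemma wordProd_append {k : ℕ} (A : Fin k → SL(2, ℝ)) (l l' : List (Fin k)) :
    wordProd A (l ++ l') = wordProd A l' * wordProd A l := by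
  induction l with
  | nil => simp [wordProd]
  | cons i l ih => simp [wordProd, ih, mul_assoc]

lemma wordProd_replicate {k : ℕ} (A : Fin k → SL(2, ℝ)) (n : ℕ) (i : Fin k) :
    wordProd A (List.replicate n i) = A i ^ n := by
  induction n with
  | zero => simp [wordProd]
  | succ n ih => simp [wordProd, List.replicate_succ, ih, pow_succ]

lemma wordProd_flatten_replicate {k : ℕ} (A : Fin k → SL(2, ℝ)) (n : ℕ) (l : List (Fin k)) :
    wordProd A (List.replicate n l).flatten = wordProd A l ^ n := by
  induction n with
  | zero => simp [wordProd]
  | succ n ih => simp [List.replicate_succ, wordProd_append, ih, pow_succ]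

lemma prodNat_eq_wordProd {k : ℕ} (A : Fin k → SL(2, ℝ)) (n : ℕ) (ω : Word k) :
    prodNat A n ω = wordProd A ((List.range n).map fun i : ℕ => ω i) := by
  induction n with
  | zero => rfl
  | succ n ih => simp [prodNat, List.range_succ, wordProd_append, ih, wordProd]

lemma continuous_wordProd {k : ℕ} (l : List (Fin k)) :
    Continuous fun A : Fin k → SL(2, ℝ) => wordProd A l := by
  induction l with
  | nil => exact continuous_const
  | cons i l ih => exact ih.mul (continuous_apply i)

/-! ### From growth of traces to uniform hyperbolicity -/

/-- The triangle inequality for the sine of the angle between two lines. -/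
lemma abs_wedge_triangle {x y z : EuclideanSpace ℝ (Fin 2)} (hx : ‖x‖ = 1) (hy : ‖y‖ = 1)
    (hz : ‖z‖ = 1) : |wedge x z| ≤ |wedge x y| + |wedge y z| := by
  have hq : ∀ u v : EuclideanSpace ℝ (Fin 2), ‖u‖ = 1 → ‖v‖ = 1 →
      |wedge u (quarterTurn v)| ≤ 1 := fun u v hu hv => by
    simpa [hu, hv] using abs_wedge_le u (quarterTurn v)
  -- The addition formula of the sine.
  have key : wedge x z = wedge x y * wedge y (quarterTurn z) +
      wedge x (quarterTurn y) * wedge y z := by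
    have h1 := norm_sq_eq y
    rw [hy] at h1
    simp [wedge, quarterTurn]
    linear_combination (x 0 * z 1 - x 1 * z 0) * h1
  rw [key]
  refine (abs_add_le _ _).trans ?_
  rw [abs_mul, abs_mul]
  have h1 := hq y z hy hz
  have h2 := hq x y hx hy
  nlinarith [abs_nonneg (wedge x y), abs_nonneg (wedge y z)]

/-- The expansion of a vector under a unimodular map depends on its direction in a Lipschitz
way. -/
lemma norm_act_le_of_wedge (M : SL(2, ℝ)) {x y : EuclideanSpace ℝ (Fin 2)} {b L : ℝ}
    (hL : opNorm M ≤ L) (hb : |wedge x y| ≤ ‖x‖ * ‖y‖ * b) :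
    ‖act M x‖ * ‖y‖ ≤ ‖act M y‖ * ‖x‖ * (1 + L ^ 2 * b) := by
  rcases eq_or_ne y 0 with rfl | hy
  · simp
  have hy : 0 < ‖y‖ := norm_pos_iff.mpr hy
  -- The decomposition of `x` along `y` and its quarter turn.
  have key : (‖y‖ ^ 2) • x = wedge x (quarterTurn y) • y - wedge x y • quarterTurn y := by
    ext i; fin_cases i
    · simp [wedge, quarterTurn, norm_sq_eq y]; ring
    · simp [wedge, quarterTurn, norm_sq_eq y]; ring
  have hM := opNorm_nonneg M
  have h1 : ‖y‖ ^ 2 * ‖act M x‖ ≤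
      ‖x‖ * ‖y‖ * ‖act M y‖ + ‖x‖ * ‖y‖ * b * (L * ‖y‖) := by
    have : ‖act M ((‖y‖ ^ 2) • x)‖ = ‖y‖ ^ 2 * ‖act M x‖ := by
      rw [map_smul, norm_smul]; simp
    rw [← this, key, map_sub, map_smul, map_smul]
    refine (norm_sub_le _ _).trans ?_
    rw [norm_smul, norm_smul, Real.norm_eq_abs, Real.norm_eq_abs]
    have e1 := abs_wedge_le x (quarterTurn y)
    rw [norm_quarterTurn] at e1
    have e2 := norm_act_le M (quarterTurn y)
    rw [norm_quarterTurn] at e2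
    have e3 : ‖act M (quarterTurn y)‖ ≤ L * ‖y‖ := e2.trans (by gcongr)
    have e4 := abs_nonneg (wedge x y)
    have e5 := e4.trans hb
    gcongr
  have h2 : ‖y‖ ≤ L * ‖act M y‖ :=
    (norm_le_opNorm_mul_norm_act M y).trans (by gcongr)
  have hLn : 0 ≤ L := hM.trans hL
  have hb0 : 0 ≤ ‖x‖ * ‖y‖ * b := (abs_nonneg _).trans hb
  have h3 : ‖x‖ * ‖y‖ * b * (L * ‖y‖) ≤ ‖x‖ * ‖y‖ * b * (L * (L * ‖act M y‖)) := by gcongr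
  have h4 : ‖y‖ * (‖act M x‖ * ‖y‖) ≤ ‖y‖ * (‖act M y‖ * ‖x‖ * (1 + L ^ 2 * b)) := by nlinarith
  exact le_of_mul_le_mul_left h4 hy

section

variable {k : ℕ} {A : Fin k → SL(2, ℝ)} {δ L : ℝ}

/-- All products of the matrices `A i` are hyperbolic, with traces growing exponentially with the
length of the product. -/
def TraceGrowth (A : Fin k → SL(2, ℝ)) (δ : ℝ) : Prop :=
  ∀ (n : ℕ) (ω : Word k), 2 * Real.exp (δ * n) ≤ |tr (prodNat A n ω)|

lemma TraceGrowth.exists_eigenvector (H : TraceGrowth A δ) (hδ : 0 < δ) (n : ℕ) (ω : Word k) :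
    ∃ v : EuclideanSpace ℝ (Fin 2), ‖v‖ = 1 ∧
      ∃ c : ℝ, |c| ≤ Real.exp (-(δ * n)) ∧ act (prodNat A n ω) v = c • v := by
  rw [Real.exp_neg]
  exact exists_contracted_eigenvector _ (Real.one_le_exp (by positivity)) (H n ω)

lemma TraceGrowth.exists_contracted (H : TraceGrowth A δ) (hδ : 0 < δ) (n : ℕ) (ω : Word k) :
    ∃ v : EuclideanSpace ℝ (Fin 2), ‖v‖ = 1 ∧
      ‖act (prodNat A n ω) v‖ ≤ Real.exp (-(δ * n)) := by
  obtain ⟨v, hv, c, hc, h⟩ := H.exists_eigenvector hδ n ω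
  exact ⟨v, hv, by rw [h, norm_smul, hv, mul_one]; exact hc⟩

/-- Directions contracted at two times `m ≤ m + d` along the same word are exponentially close in
`m`. -/
lemma TraceGrowth.abs_wedge_le_exp (H : TraceGrowth A δ) (hδ : 0 < δ) (hL : ∀ i, opNorm (A i) ≤ L)
    (hL1 : 1 ≤ L) (ω : Word k) (d : ℕ) : ∀ (m : ℕ) (x y : EuclideanSpace ℝ (Fin 2)),
    ‖x‖ = 1 → ‖y‖ = 1 → ‖act (prodNat A m ω) x‖ ≤ Real.exp (-(δ * m)) →
    ‖act (prodNat A (m + d) ω) y‖ ≤ Real.exp (-(δ * (m + d : ℕ))) →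
    |wedge x y| ≤ L / (1 - Real.exp (-(2 * δ))) * Real.exp (-(2 * δ)) ^ m := by
  have hq1 : Real.exp (-(2 * δ)) < 1 := by rw [Real.exp_lt_one_iff]; linarith
  have hq0 := Real.exp_pos (-(2 * δ))
  set q := Real.exp (-(2 * δ)) with hq
  have hexp : ∀ m : ℕ, Real.exp (-(δ * m)) * Real.exp (-(δ * m)) = q ^ m := fun m => by
    rw [hq, ← Real.exp_add, ← Real.exp_nat_mul]; congr 1; ring
  have hK : L ≤ L / (1 - q) := by
    rw [le_div_iff₀ (by linarith)]; nlinarith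
  induction d with
  | zero =>
    intro m x y hx hy h1 h2
    rw [← wedge_act (prodNat A m ω)]
    refine (abs_wedge_le _ _).trans ?_
    rw [add_zero] at h2
    calc _ ≤ Real.exp (-(δ * m)) * Real.exp (-(δ * m)) := by gcongr
      _ = 1 * q ^ m := by rw [hexp, one_mul]
      _ ≤ _ := by gcongr; linarith
  | succ d ih =>
    intro m x y hx hy h1 h2
    obtain ⟨s, hs, hsc⟩ := H.exists_contracted hδ (m + 1) ω
    have e1 : |wedge x s| ≤ L * q ^ m := by
      rw [← wedge_act (prodNat A (m + 1) ω)]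
      refine (abs_wedge_le _ _).trans ?_
      have e3 : ‖act (prodNat A (m + 1) ω) x‖ ≤ L * Real.exp (-(δ * m)) := by
        rw [prodNat, act_mul]
        exact (norm_act_le _ _).trans (by gcongr; exact hL _)
      have e4 : ‖act (prodNat A (m + 1) ω) s‖ ≤ Real.exp (-(δ * m)) :=
        hsc.trans (Real.exp_le_exp.mpr (by push_cast; nlinarith))
      calc _ ≤ (L * Real.exp (-(δ * m))) * Real.exp (-(δ * m)) := by gcongr
        _ = _ := by rw [mul_assoc, hexp]
    have e2 := ih (m + 1) s y hs hy hsc (by rwa [show m + 1 + d = m + (d + 1) by ring])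
    refine (abs_wedge_triangle hx hs hy).trans ((add_le_add e1 e2).trans ?_)
    apply le_of_eq
    have : 1 - q ≠ 0 := by linarith
    field_simp
    ring

/-- The periodic word obtained by repeating the letters at the positions `0, …, N - 1`. -/
def periodize (N : ℕ) (ω : Word k) : Word k := fun i => ω (i % N)

lemma shiftPow_periodize (N : ℕ) (ω : Word k) : shiftPow N (periodize N ω) = periodize N ω := by
  funext i; simp [shiftPow, periodize]

lemma periodize_apply {N i : ℕ} (h : i < N) (ω : Word k) : periodize N ω i = ω i := by
  simp only [periodize]; congr 1; exact Int.emod_eq_of_lt (by positivity) (by exact_mod_cast h)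

/-- The orbit of the eigenvector of a periodic word consists of eigenvectors of the cyclic
rearrangements. -/
lemma act_prodNat_shiftPow_of_periodic {N : ℕ} {p : Word k} (hp : shiftPow N p = p)
    {v : EuclideanSpace ℝ (Fin 2)} {c : ℝ} (h : act (prodNat A N p) v = c • v) (j : ℕ) :
    act (prodNat A N (shiftPow j p)) (act (prodNat A j p) v) = c • act (prodNat A j p) v := by
  rw [← act_mul, ← prodNat_add, add_comm, prodNat_add, act_mul, h, map_smul, hp]

lemma act_ne_zero (M : SL(2, ℝ)) {v : EuclideanSpace ℝ (Fin 2)} (hv : v ≠ 0) : act M v ≠ 0 := by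
  intro h; apply hv; rw [← act_inv_act M v, h, map_zero]

/-- Along a word `ω` followed for `N` steps, the stable direction of the periodic word of period
`N` is, at the time `j`, exponentially close in `n - j` to any direction contracted by the
product over the times from `j` to `n`. -/
lemma TraceGrowth.abs_wedge_periodize_le (H : TraceGrowth A δ) (hδ : 0 < δ)
    (hL : ∀ i, opNorm (A i) ≤ L) (hL1 : 1 ≤ L) (ω : Word k) {j n N : ℕ} (hj : j < n) (hn : n ≤ N)
    {v s : EuclideanSpace ℝ (Fin 2)} {c : ℝ} (hv : ‖v‖ = 1) (hc : |c| ≤ Real.exp (-(δ * N)))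
    (h : act (prodNat A N (periodize N ω)) v = c • v) (hs : ‖s‖ = 1)
    (hsc : ‖act (prodNat A (n - j) (shiftPow j ω)) s‖ ≤ Real.exp (-(δ * (n - j : ℕ)))) :
    |wedge s (‖act (prodNat A j ω) v‖⁻¹ • act (prodNat A j ω) v)| ≤
      L / (1 - Real.exp (-(2 * δ))) * Real.exp (-(2 * δ)) ^ (n - j) := by
  have h0 : act (prodNat A j ω) v ≠ 0 := act_ne_zero _ (by intro h; simp [h] at hv)
  have h0' : ‖act (prodNat A j ω) v‖ ≠ 0 := norm_ne_zero_iff.mpr h0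
  have hpj : prodNat A j ω = prodNat A j (periodize N ω) :=
    prodNat_congr A fun i hi => (periodize_apply (by omega) ω).symm
  have hunit : ‖‖act (prodNat A j ω) v‖⁻¹ • act (prodNat A j ω) v‖ = 1 := by
    rw [norm_smul, norm_inv, norm_norm, inv_mul_cancel₀ h0']
  refine H.abs_wedge_le_exp hδ hL hL1 (shiftPow j (periodize N ω)) (N - (n - j)) (n - j) _ _ hs
    hunit ?_ ?_
  · rwa [prodNat_congr A (η := shiftPow j ω)]
    intro i hi
    simp only [shiftPow_apply]
    exact_mod_cast periodize_apply (show i + j < N by omega) ω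
  · rw [show n - j + (N - (n - j)) = N by omega, map_smul, hpj,
      act_prodNat_shiftPow_of_periodic (shiftPow_periodize N ω) h, ← hpj, smul_comm, norm_smul,
      hunit, mul_one]
    exact hc

lemma norm_act_prodNat_le_of_wedge (hL : ∀ i, opNorm (A i) ≤ L) (ω : Word k)
    {x y : EuclideanSpace ℝ (Fin 2)} (hx : ‖x‖ = 1) (hy : ‖y‖ = 1) {b : ℕ → ℝ} (hb : ∀ j, 0 ≤ b j)
    (n : ℕ) (h : ∀ j < n, |wedge (act (prodNat A j ω) x) (act (prodNat A j ω) y)| ≤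
      ‖act (prodNat A j ω) x‖ * ‖act (prodNat A j ω) y‖ * b j) :
    ‖act (prodNat A n ω) x‖ ≤
      ‖act (prodNat A n ω) y‖ * Real.exp (∑ j ∈ Finset.range n, L ^ 2 * b j) := by
  induction n with
  | zero => simp [prodNat, hx, hy]
  | succ n ih =>
    have ih := ih fun j hj => h j (by omega)
    have h1 := norm_act_le_of_wedge (A (ω n)) (hL (ω n)) (h n (by omega))
    rw [Finset.sum_range_succ, Real.exp_add]
    simp only [prodNat, act_mul]
    set X := act (prodNat A n ω) x
    set Y := act (prodNat A n ω) y with hY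
    have hY0 : 0 < ‖Y‖ := norm_pos_iff.mpr (act_ne_zero _ (by intro h; simp [h] at hy))
    have h2 : 1 + L ^ 2 * b n ≤ Real.exp (L ^ 2 * b n) := by
      rw [add_comm]; exact Real.add_one_le_exp _
    have h3 : 0 ≤ 1 + L ^ 2 * b n := by have := hb n; positivity
    refine le_of_mul_le_mul_right (h1.trans ?_) hY0
    calc _ ≤ ‖act (A (ω n)) Y‖ * (‖Y‖ * Real.exp (∑ j ∈ Finset.range n, L ^ 2 * b j)) *
          Real.exp (L ^ 2 * b n) := by gcongr
      _ = _ := by ring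

lemma wedge_smul_smul (a b : ℝ) (x y : EuclideanSpace ℝ (Fin 2)) :
    wedge (a • x) (b • y) = a * b * wedge x y := by
  simp [wedge]; ring

/-- Over every word some direction is contracted at the rate of the traces, uniformly. The stable
direction of the periodic word of period `N` is contracted up to time `N`: up to time `n` it is
close to the stable direction of the periodic word of period `n`, with summable errors, and the
latter is contracted at time `n` by definition. -/
lemma TraceGrowth.exists_uniformly_contracted (H : TraceGrowth A δ) (hδ : 0 < δ) :
    ∃ C : ℝ, 0 < C ∧ ∀ ω : Word k, ∃ v : EuclideanSpace ℝ (Fin 2), ‖v‖ = 1 ∧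
      ∀ n : ℕ, ‖act (prodNat A n ω) v‖ ≤ C * Real.exp (-(δ * n)) := by
  obtain ⟨L, hL⟩ : ∃ L, ∀ i, opNorm (A i) ≤ max L 1 :=
    ⟨∑ i, opNorm (A i), fun i => le_max_of_le_left
      (Finset.single_le_sum (f := fun i => opNorm (A i)) (fun _ _ => opNorm_nonneg _)
        (Finset.mem_univ i))⟩
  have hL1 := le_max_right L 1
  set L' := max L 1
  have hq1 : Real.exp (-(2 * δ)) < 1 := by rw [Real.exp_lt_one_iff]; linarith
  have hq0 := Real.exp_pos (-(2 * δ))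
  set q := Real.exp (-(2 * δ)) with hq
  set K := L' / (1 - q) with hK
  have hK0 : 0 ≤ K := div_nonneg (by linarith) (by linarith)
  set C := Real.exp (L' ^ 2 * (2 * K) * (1 - q)⁻¹) with hC
  -- Finite time: the stable direction of the periodic word of period `N`.
  have fin : ∀ (ω : Word k) (N : ℕ), ∃ v : EuclideanSpace ℝ (Fin 2), ‖v‖ = 1 ∧
      ∀ n ≤ N, ‖act (prodNat A n ω) v‖ ≤ C * Real.exp (-(δ * n)) := by
    intro ω N
    obtain ⟨v, hv, c, hc, hvc⟩ := H.exists_eigenvector hδ N (periodize N ω)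
    refine ⟨v, hv, fun n hn => ?_⟩
    obtain ⟨u, hu, c', hc', huc⟩ := H.exists_eigenvector hδ n (periodize n ω)
    have hun : ‖act (prodNat A n ω) u‖ ≤ Real.exp (-(δ * n)) := by
      rw [prodNat_congr A (η := periodize n ω) fun i hi => (periodize_apply hi ω).symm, huc,
        norm_smul, hu, mul_one]
      exact hc'
    have hsum : ∑ j ∈ Finset.range n, L' ^ 2 * (2 * K * q ^ (n - j)) ≤
        L' ^ 2 * (2 * K) * (1 - q)⁻¹ := by
      rw [← Finset.sum_range_reflect]
      calc _ ≤ ∑ j ∈ Finset.range n, L' ^ 2 * (2 * K) * q ^ j := by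
            refine Finset.sum_le_sum fun j hj => ?_
            rw [Finset.mem_range] at hj
            rw [show n - (n - 1 - j) = j + 1 by omega, pow_succ q j]
            have h1 : q ^ j * q ≤ q ^ j := by nlinarith [pow_pos hq0 j]
            have h2 : L' ^ 2 * (2 * K) * (q ^ j * q) ≤ L' ^ 2 * (2 * K) * q ^ j :=
              mul_le_mul_of_nonneg_left h1 (by positivity)
            linarith
        _ = L' ^ 2 * (2 * K) * ∑ j ∈ Finset.range n, q ^ j := by rw [Finset.mul_sum]
        _ ≤ _ := by
            gcongr
            rw [← tsum_geometric_of_lt_one hq0.le hq1]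
            exact (summable_geometric_of_lt_one hq0.le hq1).sum_le_tsum _ fun _ _ => by positivity
    refine (norm_act_prodNat_le_of_wedge hL ω hv hu (b := fun j => 2 * K * q ^ (n - j))
      (fun j => by positivity) n fun j hj => ?_).trans ?_
    · obtain ⟨s, hs, hsc⟩ := H.exists_contracted hδ (n - j) (shiftPow j ω)
      have e1 := H.abs_wedge_periodize_le hδ hL hL1 ω hj hn hv hc hvc hs hsc
      have e2 := H.abs_wedge_periodize_le hδ hL hL1 ω hj le_rfl hu hc' huc hs hsc
      set X := act (prodNat A j ω) v with hX
      set Y := act (prodNat A j ω) u with hY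
      have hX0 : 0 < ‖X‖ := norm_pos_iff.mpr (act_ne_zero _ (by intro h; simp [h] at hv))
      have hY0 : 0 < ‖Y‖ := norm_pos_iff.mpr (act_ne_zero _ (by intro h; simp [h] at hu))
      have hXu : ‖‖X‖⁻¹ • X‖ = 1 := by
        rw [norm_smul, norm_inv, norm_norm, inv_mul_cancel₀ hX0.ne']
      have hYu : ‖‖Y‖⁻¹ • Y‖ = 1 := by
        rw [norm_smul, norm_inv, norm_norm, inv_mul_cancel₀ hY0.ne']
      have e3 := abs_wedge_triangle hXu hs hYu
      have e4 : ∀ a b, |wedge a b| = |wedge b a| := fun a b => by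
        rw [← abs_neg]; congr 1; simp [wedge]; ring
      rw [e4 _ s, wedge_smul_smul, abs_mul, abs_of_pos (by positivity)] at e3
      have e5 : |wedge X Y| = ‖X‖ * ‖Y‖ * (‖X‖⁻¹ * ‖Y‖⁻¹ * |wedge X Y|) := by
        field_simp
      rw [e5]
      refine mul_le_mul_of_nonneg_left ?_ (by positivity)
      linarith
    · rw [mul_comm C]
      exact mul_le_mul hun (Real.exp_le_exp.mpr hsum) (Real.exp_nonneg _) (Real.exp_nonneg _)
  refine ⟨C, Real.exp_pos _, fun ω => ?_⟩
  choose v hv1 hv2 using fin ω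
  obtain ⟨a, ha, φ, hφ, hlim⟩ := (isCompact_sphere (0 : EuclideanSpace ℝ (Fin 2)) 1).tendsto_subseq
    (x := v) fun N => by simpa using hv1 N
  refine ⟨a, by simpa using ha, fun n => ?_⟩
  refine le_of_tendsto (((act (prodNat A n ω)).continuous.tendsto a).comp hlim).norm ?_
  filter_upwards [eventually_ge_atTop n] with N hN
  exact hv2 _ _ (hN.trans (hφ.id_le N))

end

/-! ### The hyperbolic splitting -/

section

variable {k : ℕ} {A : Fin k → SL(2, ℝ)} {δ : ℝ}

/-- The word read backwards. -/
def reverse (ω : Word k) : Word k := fun i => ω (-1 - i)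

@[simp] lemma reverse_reverse (ω : Word k) : reverse (reverse ω) = ω := by
  funext i; simp [reverse]

lemma prodNat_inv_reverse (A : Fin k → SL(2, ℝ)) (n : ℕ) (ω : Word k) :
    prodNat (fun i => (A i)⁻¹) n (reverse ω) = (prodNat A n (shiftPow (-n) ω))⁻¹ := by
  induction n with
  | zero => simp [prodNat]
  | succ n ih =>
    rw [prodNat_succ' A n, mul_inv_rev, prodNat, ih, shift, ← shiftPow_add]
    have e : (1 : ℤ) + -((n + 1 : ℕ) : ℤ) = -n := by push_cast; ring
    rw [e, shiftPow_apply, reverse]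
    congr 3
    push_cast; congr 1; ring

lemma TraceGrowth.inv (H : TraceGrowth A δ) : TraceGrowth (fun i => (A i)⁻¹) δ := by
  intro n ω
  rw [← reverse_reverse ω, prodNat_inv_reverse, tr_inv]
  exact H n _

/-- The vectors whose forward orbit is bounded. -/
def boundedSubspace (A : Fin k → SL(2, ℝ)) (ω : Word k) :
    Submodule ℝ (EuclideanSpace ℝ (Fin 2)) where
  carrier := {v | ∃ C : ℝ, ∀ n : ℕ, ‖act (prodNat A n ω) v‖ ≤ C}
  zero_mem' := ⟨0, by simp⟩
  add_mem' := by
    rintro a b ⟨C, hC⟩ ⟨D, hD⟩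
    refine ⟨C + D, fun n => ?_⟩
    rw [map_add]
    exact (norm_add_le _ _).trans (add_le_add (hC n) (hD n))
  smul_mem' := by
    rintro c a ⟨C, hC⟩
    refine ⟨‖c‖ * C, fun n => ?_⟩
    rw [map_smul, norm_smul]
    gcongr; exact hC n

lemma mem_boundedSubspace {ω : Word k} {v : EuclideanSpace ℝ (Fin 2)} :
    v ∈ boundedSubspace A ω ↔ ∃ C : ℝ, ∀ n : ℕ, ‖act (prodNat A n ω) v‖ ≤ C := Iff.rfl

lemma act_mem_boundedSubspace_iff (ω : Word k) (v : EuclideanSpace ℝ (Fin 2)) :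
    act (A (ω 0)) v ∈ boundedSubspace A (shift ω) ↔ v ∈ boundedSubspace A ω := by
  simp only [mem_boundedSubspace]
  have e : ∀ n, act (prodNat A n (shift ω)) (act (A (ω 0)) v) = act (prodNat A (n + 1) ω) v :=
    fun n => by rw [prodNat_succ', act_mul]
  simp only [e]
  constructor
  · rintro ⟨C, hC⟩
    refine ⟨max C ‖v‖, fun n => ?_⟩
    cases n with
    | zero => simp [prodNat]
    | succ n => exact (hC n).trans (le_max_left _ _)
  · rintro ⟨C, hC⟩
    exact ⟨C, fun n => hC _⟩

lemma TraceGrowth.boundedSubspace_eq_span (H : TraceGrowth A δ) (hδ : 0 < δ) {ω : Word k}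
    {v : EuclideanSpace ℝ (Fin 2)} (hv : v ≠ 0) (hvb : v ∈ boundedSubspace A ω) :
    boundedSubspace A ω = Submodule.span ℝ {v} := by
  refine le_antisymm (fun x hx => ?_) (by simpa using hvb)
  by_contra hxv
  -- Two independent bounded orbits would bound the products, whose traces are unbounded.
  have htop : boundedSubspace A ω = ⊤ := by
    apply Submodule.eq_top_of_finrank_eq
    refine le_antisymm (Submodule.finrank_le _) ?_
    have hli : LinearIndependent ℝ ![v, x] := by
      rw [LinearIndependent.pair_iff' hv]
      intro a ha
      exact hxv (Submodule.mem_span_singleton.mpr ⟨a, ha⟩)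
    have h2 : Submodule.span ℝ (Set.range ![v, x]) ≤ boundedSubspace A ω := by
      rw [Submodule.span_le]; rintro _ ⟨i, rfl⟩; fin_cases i
      · exact hvb
      · exact hx
    have h3 := Submodule.finrank_mono h2
    rw [finrank_span_eq_card hli] at h3
    simpa using h3
  have hb : ∀ i, ∃ C, ∀ n, ‖act (prodNat A n ω) (EuclideanSpace.single i (1 : ℝ))‖ ≤ C := fun i =>
    mem_boundedSubspace.mp (htop ▸ Submodule.mem_top)
  choose C hC using hb
  have ht : ∀ n, |tr (prodNat A n ω)| ≤ C 0 + C 1 := by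
    intro n
    have h0 := (PiLp.norm_apply_le (act (prodNat A n ω) (EuclideanSpace.single 0 1)) 0).trans
      (hC 0 n)
    have h1 := (PiLp.norm_apply_le (act (prodNat A n ω) (EuclideanSpace.single 1 1)) 1).trans
      (hC 1 n)
    simp at h0 h1
    exact (abs_add_le _ _).trans (add_le_add h0 h1)
  obtain ⟨n, hn⟩ := exists_nat_gt ((C 0 + C 1) / δ)
  rw [div_lt_iff₀ hδ] at hn
  have h1 := H n ω
  have h2 := Real.add_one_le_exp (δ * n)
  have h3 := ht n
  have h4 : 0 ≤ δ * n := by positivity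
  linarith

/-- The vectors with bounded forward orbit form a line, which is uniformly contracted. -/
lemma TraceGrowth.boundedSubspace_spec (H : TraceGrowth A δ) (hδ : 0 < δ) :
    ∃ C : ℝ, 0 < C ∧ ∀ ω : Word k, Module.finrank ℝ (boundedSubspace A ω) = 1 ∧
      ∀ v ∈ boundedSubspace A ω, ∀ n : ℕ,
        ‖act (prodNat A n ω) v‖ ≤ C * Real.exp (-(δ * n)) * ‖v‖ := by
  obtain ⟨C, hC, h⟩ := H.exists_uniformly_contracted hδ
  refine ⟨C, hC, fun ω => ?_⟩
  obtain ⟨v, hv, hvn⟩ := h ω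
  have hv0 : v ≠ 0 := by intro h; simp [h] at hv
  have hvb : v ∈ boundedSubspace A ω := mem_boundedSubspace.mpr ⟨C, fun n => (hvn n).trans <| by
    have : Real.exp (-(δ * n)) ≤ 1 := by rw [Real.exp_le_one_iff]; simp; positivity
    nlinarith⟩
  rw [H.boundedSubspace_eq_span hδ hv0 hvb]
  refine ⟨finrank_span_singleton hv0, fun x hx n => ?_⟩
  obtain ⟨a, rfl⟩ := Submodule.mem_span_singleton.mp hx
  rw [map_smul, norm_smul, norm_smul, hv, mul_one, mul_comm]
  exact mul_le_mul_of_nonneg_right (hvn n) (norm_nonneg _)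

/-- If the traces of all products grow uniformly exponentially, the cocycle is uniformly
hyperbolic: the stable line consists of the vectors with bounded forward orbit, and the unstable
line of those with bounded backward orbit. -/
theorem TraceGrowth.uniformlyHyperbolic (H : TraceGrowth A δ) (hδ : 0 < δ) :
    UniformlyHyperbolic A := by
  obtain ⟨C, hC, hs⟩ := H.boundedSubspace_spec hδ
  obtain ⟨D, hD, hu⟩ := H.inv.boundedSubspace_spec hδ
  set B : Fin k → SL(2, ℝ) := fun i => (A i)⁻¹ with hB
  have hrev : ∀ ω : Word k, shift (reverse (shift ω)) = reverse ω := fun ω => by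
    funext i; simp only [shift, shiftPow, reverse]; congr 1; ring
  have hrev0 : ∀ ω : Word k, reverse (shift ω) 0 = ω 0 := fun ω => by
    simp [shift, shiftPow, reverse]
  have hmemu : ∀ (ω : Word k) v, act (A (ω 0)) v ∈ boundedSubspace B (reverse (shift ω)) ↔
      v ∈ boundedSubspace B (reverse ω) := fun ω v => by
    rw [← act_mem_boundedSubspace_iff, hrev, hrev0, hB, act_inv_act]
  have hmap : ∀ (M : SL(2, ℝ)) (V W : Submodule ℝ (EuclideanSpace ℝ (Fin 2))),
      (∀ v, act M v ∈ W ↔ v ∈ V) → V.map (act M).toLinearMap = W := fun M V W h => by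
    ext w
    constructor
    · rintro ⟨v, hv, rfl⟩; exact (h v).mpr hv
    · intro hw
      exact ⟨act M⁻¹ w, (h _).mp (by simpa using hw), by simp⟩
  have hiter : ∀ (n : ℕ) (ω : Word k) v, v ∈ boundedSubspace B (reverse ω) →
      act (prodNat A n ω) v ∈ boundedSubspace B (reverse (shiftPow n ω)) := by
    intro n
    induction n with
    | zero => intro ω v hv; simpa [prodNat] using hv
    | succ n ih =>
      intro ω v hv
      rw [prodNat_succ', act_mul]
      have := ih (shift ω) _ ((hmemu ω v).mpr hv)
      rw [shift, ← shiftPow_add] at this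
      exact_mod_cast this
  have hexpand : ∀ (ω : Word k) (n : ℕ), ∀ v ∈ boundedSubspace B (reverse ω),
      D⁻¹ * Real.exp (δ * n) * ‖v‖ ≤ ‖act (prodNat A n ω) v‖ := by
    intro ω n v hv
    have h1 := (hu (reverse (shiftPow n ω))).2 _ (hiter n ω v hv) n
    rw [prodNat_inv_reverse, ← shiftPow_add, neg_add_cancel, shiftPow_zero, act_inv_act,
      Real.exp_neg] at h1
    have h2 := Real.exp_pos (δ * n)
    calc _ ≤ D⁻¹ * Real.exp (δ * n) *
          (D * (Real.exp (δ * n))⁻¹ * ‖act (prodNat A n ω) v‖) := by gcongr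
      _ = _ := by field_simp
  refine ⟨fun ω => boundedSubspace B (reverse ω), fun ω => boundedSubspace A ω,
    fun ω => ⟨(hu _).1, (hs ω).1, ?_⟩, fun ω => ⟨hmap _ _ _ (hmemu ω), hmap _ _ _ fun v =>
      act_mem_boundedSubspace_iff ω v⟩, D⁻¹, C, δ, by positivity, hC, hδ,
    fun ω n => ⟨hexpand ω n, fun v hv => (hs ω).2 v hv n⟩⟩
  have hdisj : Disjoint (boundedSubspace B (reverse ω)) (boundedSubspace A ω) := by
    rw [Submodule.disjoint_def]
    rintro v hv ⟨M, hM⟩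
    by_contra hv0
    have hv0 : 0 < ‖v‖ := norm_pos_iff.mpr hv0
    have hpos : 0 < D⁻¹ * ‖v‖ * δ := by positivity
    obtain ⟨n, hn⟩ := exists_nat_gt (M / (D⁻¹ * ‖v‖ * δ))
    rw [div_lt_iff₀ hpos] at hn
    have h1 := (hexpand ω n v hv).trans (hM n)
    have h2 := Real.add_one_le_exp (δ * n)
    have h3 : D⁻¹ * (δ * n) * ‖v‖ ≤ D⁻¹ * Real.exp (δ * n) * ‖v‖ := by gcongr; linarith
    nlinarith
  refine Submodule.isCompl_iff_disjoint _ _ ?_ |>.mpr hdisj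
  simp [(hu (reverse ω)).1, (hs ω).1]

end

/-! ### Rotating the generators: a real-rooted polynomial -/

section

variable {k : ℕ} (A : Fin k → SL(2, ℝ))

/-- The rotation by the angle `arctan x`. -/
noncomputable def rotTan (x : ℝ) : SL(2, ℝ) :=
  ⟨!![(Real.sqrt (1 + x ^ 2))⁻¹, -x * (Real.sqrt (1 + x ^ 2))⁻¹;
      x * (Real.sqrt (1 + x ^ 2))⁻¹, (Real.sqrt (1 + x ^ 2))⁻¹], by
    have h : Real.sqrt (1 + x ^ 2) ^ 2 = 1 + x ^ 2 := Real.sq_sqrt (by positivity)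
    have h0 : Real.sqrt (1 + x ^ 2) ≠ 0 := by positivity
    rw [Matrix.det_fin_two_of]; field_simp; linarith⟩

@[simp] lemma rotTan_zero : rotTan 0 = 1 := by
  ext i j; fin_cases i <;> fin_cases j <;> simp [rotTan]

lemma continuous_rotTan : Continuous rotTan := by
  refine Continuous.subtype_mk ?_ _
  have h : Continuous fun x : ℝ => (Real.sqrt (1 + x ^ 2))⁻¹ :=
    Continuous.inv₀ (by fun_prop) fun x => by positivity
  refine continuous_matrix fun i j => ?_
  fin_cases i <;> fin_cases j <;> simp <;> fun_prop

/-- The generators, each followed by the rotation by `arctan x`. -/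
noncomputable def tilt (x : ℝ) : Fin k → SL(2, ℝ) := fun i => rotTan x * A i

lemma tilt_zero : tilt A 0 = A := by
  funext i; simp [tilt]

lemma continuous_tilt : Continuous fun x => tilt A x :=
  continuous_pi fun _ => continuous_rotTan.mul continuous_const

/-- The product along a word of the matrices `(1 + z J) A i`, with `J` the rotation by a right
angle and `z` in a commutative ring over the reals. -/
noncomputable def tiltProd {R : Type*} [CommRing R] [Algebra ℝ R] (z : R) :
    List (Fin k) → Matrix (Fin 2) (Fin 2) R
  | [] => 1
  | i :: l => tiltProd z l * (!![1, -z; z, 1] *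
      ((A i : Matrix (Fin 2) (Fin 2) ℝ).map (algebraMap ℝ R)))

lemma tiltProd_map {R S : Type*} [CommRing R] [Algebra ℝ R] [CommRing S] [Algebra ℝ S]
    (f : R →ₐ[ℝ] S) (z : R) (l : List (Fin k)) :
    (tiltProd A z l).map f = tiltProd A (f z) l := by
  induction l with
  | nil => simp [tiltProd]
  | cons i l ih =>
    rw [tiltProd, Matrix.map_mul, ih, tiltProd, Matrix.map_mul]
    congr 2
    · ext a b; fin_cases a <;> fin_cases b <;> simp
    · ext a b; simp

lemma tiltProd_ofReal (x : ℝ) (l : List (Fin k)) :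
    tiltProd A (x : ℝ) l = Real.sqrt (1 + x ^ 2) ^ l.length •
      (wordProd (tilt A x) l : Matrix (Fin 2) (Fin 2) ℝ) := by
  induction l with
  | nil => simp [tiltProd, wordProd]
  | cons i l ih =>
    have h0 : Real.sqrt (1 + x ^ 2) ≠ 0 := by positivity
    have h : (!![1, -x; x, 1] : Matrix (Fin 2) (Fin 2) ℝ) =
        Real.sqrt (1 + x ^ 2) • (rotTan x : Matrix (Fin 2) (Fin 2) ℝ) := by
      ext a b; fin_cases a <;> fin_cases b <;> simp [rotTan] <;> field_simp
    rw [tiltProd, ih, wordProd, tilt, h]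
    simp [pow_succ, smul_smul, mul_comm]

lemma det_tiltProd {R : Type*} [CommRing R] [Algebra ℝ R] (z : R) (l : List (Fin k)) :
    (tiltProd A z l).det = (1 + z ^ 2) ^ l.length := by
  induction l with
  | nil => simp [tiltProd]
  | cons i l ih =>
    have : ((A i : Matrix (Fin 2) (Fin 2) ℝ).map (algebraMap ℝ R)).det = 1 := by
      have := (algebraMap ℝ R).map_det (A i : Matrix (Fin 2) (Fin 2) ℝ)
      rw [(A i).det_coe, map_one] at this
      exact this.symm
    rw [tiltProd, Matrix.det_mul, Matrix.det_mul, ih, this, Matrix.det_fin_two_of]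
    simp [pow_succ]

/-- The indefinite Hermitian form on `ℂ²` preserved by `SL(2, ℝ)`; its positive vectors are the
lines in the upper half plane. -/
noncomputable def hermForm (v : Fin 2 → ℂ) : ℝ := ((starRingEnd ℂ) (v 0) * v 1).im

lemma hermForm_tilt_le {z : ℂ} (hz : 0 < z.im) (v : Fin 2 → ℂ) :
    (1 + ‖z‖ ^ 2 + 2 * z.im) * hermForm v ≤
      hermForm (Matrix.mulVec !![1, -z; z, 1] v) := by
  have h : 2 * hermForm v ≤ ‖v 0‖ ^ 2 + ‖v 1‖ ^ 2 := by
    simp only [hermForm, Complex.sq_norm, Complex.normSq_apply, Complex.mul_im, Complex.conj_re,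
      Complex.conj_im]
    nlinarith [sq_nonneg ((v 0).re - (v 1).im), sq_nonneg ((v 0).im + (v 1).re)]
  have e : hermForm (Matrix.mulVec !![1, -z; z, 1] v) =
      z.im * (‖v 0‖ ^ 2 + ‖v 1‖ ^ 2) + (1 + ‖z‖ ^ 2) * hermForm v := by
    simp [hermForm, Matrix.mulVec, dotProduct, Fin.sum_univ_two, Complex.sq_norm,
      Complex.normSq_apply]
    ring
  rw [e]
  nlinarith

lemma hermForm_mulVec_map (M : SL(2, ℝ)) (v : Fin 2 → ℂ) :
    hermForm (Matrix.mulVec ((M : Matrix (Fin 2) (Fin 2) ℝ).map (algebraMap ℝ ℂ)) v) =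
      hermForm v := by
  simp [hermForm, Matrix.mulVec, dotProduct, Fin.sum_univ_two]
  linear_combination ((v 0).re * (v 1).im - (v 0).im * (v 1).re) * det_eq_one M

lemma hermForm_tiltProd_le {z : ℂ} (hz : 0 < z.im) (l : List (Fin k)) (v : Fin 2 → ℂ) :
    (1 + ‖z‖ ^ 2 + 2 * z.im) ^ l.length * hermForm v ≤
      hermForm (Matrix.mulVec (tiltProd A z l) v) := by
  induction l generalizing v with
  | nil => simp [tiltProd]
  | cons i l ih =>
    rw [tiltProd, ← Matrix.mulVec_mulVec, ← Matrix.mulVec_mulVec]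
    refine le_trans ?_ (ih _)
    rw [List.length_cons, pow_succ, mul_assoc]
    refine mul_le_mul_of_nonneg_left ?_ (by positivity)
    refine le_trans ?_ (hermForm_tilt_le hz _)
    rw [hermForm_mulVec_map]

/-- The product of the matrices `(1 + z J) A i` has nonzero trace when `z` is in the upper half
plane. Otherwise its square `G²` would be the scalar `-det G`, of modulus `|1 + z²|ⁿ`, whereas
`G²` multiplies the Hermitian form by at least `(1 + |z|² + 2 Im z)²ⁿ`. -/
lemma trace_tiltProd_ne_zero_of_im_pos {z : ℂ} (hz : 0 < z.im) {l : List (Fin k)} (hl : l ≠ []) :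
    (tiltProd A z l).trace ≠ 0 := by
  intro h0
  set G := tiltProd A z l with hG
  have hsq : G * G = (-G.det) • (1 : Matrix (Fin 2) (Fin 2) ℂ) := by
    rw [Matrix.trace_fin_two] at h0
    have h1 : G 1 1 = -G 0 0 := by linear_combination h0
    ext a b
    fin_cases a <;> fin_cases b <;>
      simp [Matrix.mul_apply, Fin.sum_univ_two, Matrix.det_fin_two, h1] <;> ring
  set e : Fin 2 → ℂ := ![1, Complex.I] with he
  have hκ : (0 : ℝ) < 1 + ‖z‖ ^ 2 + 2 * z.im := by positivity
  have h1 : (1 + ‖z‖ ^ 2 + 2 * z.im) ^ l.length * (1 + ‖z‖ ^ 2 + 2 * z.im) ^ l.length ≤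
      ‖G.det‖ ^ 2 := by
    have e1 := hermForm_tiltProd_le A hz l e
    have e2 := hermForm_tiltProd_le A hz l (Matrix.mulVec G e)
    rw [← hG, Matrix.mulVec_mulVec, hsq] at e2
    have e3 : hermForm e = 1 := by simp [hermForm, he]
    have e4 : hermForm (Matrix.mulVec ((-G.det) • (1 : Matrix (Fin 2) (Fin 2) ℂ)) e) =
        ‖G.det‖ ^ 2 := by
      rw [Matrix.smul_mulVec, Matrix.one_mulVec]
      simp [hermForm, he, Complex.sq_norm, Complex.normSq_apply]
    rw [e4] at e2
    rw [e3, mul_one] at e1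
    exact le_trans (mul_le_mul_of_nonneg_left e1 (by positivity)) e2
  have h2 : ‖1 + z ^ 2‖ < 1 + ‖z‖ ^ 2 + 2 * z.im := by
    have := norm_add_le (1 : ℂ) (z ^ 2)
    rw [norm_one, norm_pow] at this
    linarith
  have h3 := pow_lt_pow_left₀ h2 (norm_nonneg _) (by simpa using hl : l.length ≠ 0)
  rw [hG, det_tiltProd, norm_pow] at h1
  have h4 : 0 ≤ ‖1 + z ^ 2‖ ^ l.length := by positivity
  nlinarith

lemma trace_tiltProd_ne_zero {z : ℂ} (hz : z.im ≠ 0) {l : List (Fin k)} (hl : l ≠ []) :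
    (tiltProd A z l).trace ≠ 0 := by
  rcases hz.lt_or_gt with h | h
  · intro h0
    have := trace_tiltProd_ne_zero_of_im_pos A (z := (starRingEnd ℂ) z) (by simpa using h) hl
    have e := tiltProd_map A Complex.conjAe.toAlgHom z l
    apply this
    have e2 : (starRingEnd ℂ) z = Complex.conjAe.toAlgHom z := rfl
    rw [e2, ← e]
    have e3 : ((tiltProd A z l).map Complex.conjAe.toAlgHom).trace =
        (starRingEnd ℂ) (tiltProd A z l).trace := by
      simp [Matrix.trace_fin_two]
    rw [e3, h0, map_zero]
  · exact trace_tiltProd_ne_zero_of_im_pos A h hl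

/-- The trace of the product along a word of the matrices `(1 + X J) A i`. -/
noncomputable def tracePoly (l : List (Fin k)) : Polynomial ℂ :=
  (tiltProd A (Polynomial.X : Polynomial ℂ) l).trace

lemma eval_tracePoly (z : ℂ) (l : List (Fin k)) :
    (tracePoly A l).eval z = (tiltProd A z l).trace := by
  have e := tiltProd_map A ((Polynomial.aeval z : Polynomial ℂ →ₐ[ℂ] ℂ).restrictScalars ℝ)
    Polynomial.X l
  simp only [AlgHom.restrictScalars_apply, Polynomial.aeval_X] at e
  rw [← e, tracePoly]
  simp [Matrix.trace_fin_two]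

lemma eval_tracePoly_ofReal (x : ℝ) (l : List (Fin k)) :
    (tracePoly A l).eval (x : ℂ) =
      ((Real.sqrt (1 + x ^ 2) ^ l.length * tr (wordProd (tilt A x) l) : ℝ) : ℂ) := by
  have e := tiltProd_map A (Algebra.ofId ℝ ℂ) x l
  rw [eval_tracePoly, show (x : ℂ) = Algebra.ofId ℝ ℂ x from rfl, ← e, tiltProd_ofReal]
  simp [Matrix.trace_fin_two, tr, Algebra.ofId_apply]
  ring

lemma norm_eval_tracePoly_ofReal (x : ℝ) (l : List (Fin k)) :
    ‖(tracePoly A l).eval (x : ℂ)‖ =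
      Real.sqrt (1 + x ^ 2) ^ l.length * |tr (wordProd (tilt A x) l)| := by
  rw [eval_tracePoly_ofReal, Complex.norm_real, Real.norm_eq_abs, abs_mul,
    abs_of_nonneg (by positivity)]

/-- If no product of the tilted generators is elliptic for parameters up to `τ`, then the roots of
the trace polynomial are real and at distance at least `τ` from `0`; comparing the factors at `0`
and at `± τ` gives exponential growth of the traces. -/
lemma abs_tr_wordProd_ge {τ : ℝ} (h : ∀ x : ℝ, |x| ≤ τ → ∀ l : List (Fin k),
    2 ≤ |tr (wordProd (tilt A x) l)|) (hτ : 0 < τ) (l : List (Fin k)) :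
    2 * Real.sqrt (1 + τ ^ 2) ^ l.length ≤ |tr (wordProd A l)| := by
  rcases eq_or_ne l [] with rfl | hl
  · have := h 0 (by simpa using hτ.le) []
    rw [tilt_zero] at this
    simpa using this
  set p := tracePoly A l with hp
  have hroot : ∀ r ∈ p.roots, ‖((τ : ℂ) - r) * (((-τ : ℝ) : ℂ) - r)‖ ≤ ‖(0 - r) * (0 - r)‖ := by
    intro r hr
    have hr0 : p.eval r = 0 := (Polynomial.mem_roots'.mp hr).2
    have him : r.im = 0 := by
      by_contra him
      exact trace_tiltProd_ne_zero A him hl (by rw [← eval_tracePoly]; exact hr0)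
    obtain ⟨x, rfl⟩ : ∃ x : ℝ, (x : ℂ) = r := ⟨r.re, Complex.ext rfl (by simp [him])⟩
    have hx : τ < |x| := by
      by_contra! hx
      have h1 := norm_eval_tracePoly_ofReal A x l
      rw [← hp, hr0, norm_zero] at h1
      have h2 := h x hx l
      have h3 : 0 < Real.sqrt (1 + x ^ 2) ^ l.length := by positivity
      nlinarith
    have e1 : ((τ : ℂ) - x) * (((-τ : ℝ) : ℂ) - x) = ((x ^ 2 - τ ^ 2 : ℝ) : ℂ) := by
      push_cast; ring
    have e2 : ((0 : ℂ) - x) * (0 - x) = ((x ^ 2 : ℝ) : ℂ) := by push_cast; ring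
    have h3 : τ ^ 2 < x ^ 2 := sq_lt_sq.mpr (by rwa [abs_of_pos hτ])
    rw [e1, e2, Complex.norm_real, Complex.norm_real, Real.norm_of_nonneg (by linarith),
      Real.norm_of_nonneg (by positivity)]
    nlinarith
  have hev : ∀ z, p.eval z = p.leadingCoeff * (p.roots.map fun r => z - r).prod := fun z =>
    (IsAlgClosed.splits p).eval_eq_prod_roots z
  have hmul : ∀ z w, ‖p.eval z * p.eval w‖ =
      ‖p.leadingCoeff‖ ^ 2 * (p.roots.map fun r => ‖(z - r) * (w - r)‖).prod := fun z w => by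
    rw [hev, hev, show ∀ a b c : ℂ, a * b * (a * c) = a ^ 2 * (b * c) by intros; ring,
      ← Multiset.prod_map_mul, norm_mul, norm_pow]
    congr 1
    have := map_multiset_prod (normHom : ℂ →*₀ ℝ) (p.roots.map fun r => (z - r) * (w - r))
    rw [Multiset.map_map] at this
    exact this
  have hle : ‖p.eval (τ : ℂ) * p.eval ((-τ : ℝ) : ℂ)‖ ≤ ‖p.eval 0 * p.eval 0‖ := by
    rw [hmul, hmul]
    refine mul_le_mul_of_nonneg_left ?_ (by positivity)
    exact Multiset.prod_map_le_prod_map₀ _ _ (fun _ _ => norm_nonneg _) hroot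
  have e0 := norm_eval_tracePoly_ofReal A 0 l
  simp only [Complex.ofReal_zero, tilt_zero] at e0
  have e1 := norm_eval_tracePoly_ofReal A τ l
  have e2 := norm_eval_tracePoly_ofReal A (-τ) l
  rw [norm_mul, norm_mul, hp, e0, e1, e2] at hle
  have h1 := h τ (abs_of_pos hτ).le l
  have h2 := h (-τ) (by rw [abs_neg, abs_of_pos hτ]) l
  simp only [neg_sq, ne_eq, OfNat.ofNat_ne_zero, not_false_eq_true, zero_pow, add_zero,
    Real.sqrt_one, one_pow, one_mul] at hle
  set s := Real.sqrt (1 + τ ^ 2) ^ l.length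
  have hs : 0 ≤ s := by positivity
  refine le_of_sq_le_sq ?_ (abs_nonneg _)
  calc (2 * s) ^ 2 = (s * 2) * (s * 2) := by ring
    _ ≤ _ := by gcongr
    _ ≤ _ := hle
    _ = _ := by ring

/-- The trace of a nonempty product of the tilted generators takes each value finitely often: the
trace polynomial does not vanish at `i`, while `1 + X²` does. -/
lemma finite_setOf_tr_tilt_eq {l : List (Fin k)} (hl : l ≠ []) (c : ℝ) :
    {x : ℝ | tr (wordProd (tilt A x) l) = c}.Finite := by
  set q : Polynomial ℂ := tracePoly A l ^ 2 -
    Polynomial.C ((c : ℂ) ^ 2) * (1 + Polynomial.X ^ 2) ^ l.length with hq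
  have hl' : l.length ≠ 0 := by simpa using hl
  have hq0 : q ≠ 0 := by
    intro h0
    have h1 : q.eval Complex.I = 0 := by rw [h0]; simp
    rw [hq] at h1
    simp [hl', eval_tracePoly] at h1
    exact trace_tiltProd_ne_zero A (by simp) hl h1
  refine ((q.roots.toFinset.finite_toSet).preimage
    (f := fun x : ℝ => (x : ℂ)) Complex.ofReal_injective.injOn).subset fun x hx => ?_
  simp only [Set.mem_preimage, Finset.mem_coe, Multiset.mem_toFinset, Polynomial.mem_roots hq0,
    Polynomial.IsRoot.def]
  change tr (wordProd (tilt A x) l) = c at hx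
  rw [hq]
  simp only [Polynomial.eval_sub, Polynomial.eval_pow, Polynomial.eval_mul, Polynomial.eval_C,
    Polynomial.eval_add, Polynomial.eval_one, Polynomial.eval_X, eval_tracePoly_ofReal, hx]
  have : (((Real.sqrt (1 + x ^ 2) ^ l.length) ^ 2 : ℝ) : ℂ) = (1 + (x : ℂ) ^ 2) ^ l.length := by
    rw [← pow_mul, mul_comm, pow_mul, Real.sq_sqrt (by positivity)]; push_cast; rfl
  rw [← this]; push_cast; ring

/-- Some product of the generators is elliptic. -/
def HasElliptic (A : Fin k → SL(2, ℝ)) : Prop := ∃ l : List (Fin k), |tr (wordProd A l)| < 2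

/-- Families without elliptic products in a whole neighbourhood are uniformly hyperbolic. -/
theorem uniformlyHyperbolic_of_notMem_closure (hA : A ∉ closure {B | HasElliptic B}) :
    UniformlyHyperbolic A := by
  have h1 : ∀ᶠ x in 𝓝 (0 : ℝ), tilt A x ∉ closure {B | HasElliptic B} := by
    have := (continuous_tilt A).tendsto 0
    rw [tilt_zero] at this
    exact this (isClosed_closure.isOpen_compl.mem_nhds hA)
  obtain ⟨ε, hε, hball⟩ := Metric.eventually_nhds_iff.mp h1
  have hgr : TraceGrowth A (Real.log (1 + (ε / 2) ^ 2) / 2) := by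
    intro n ω
    have h2 := abs_tr_wordProd_ge A (τ := ε / 2) (fun x hx l => by
      by_contra! hlt
      exact hball (by rw [Real.dist_eq, sub_zero]; linarith) (subset_closure ⟨l, hlt⟩))
      (by positivity) ((List.range n).map fun i : ℕ => ω i)
    rw [← prodNat_eq_wordProd] at h2
    refine le_trans (le_of_eq ?_) h2
    rw [List.length_map, List.length_range, mul_comm _ (n : ℝ), Real.exp_nat_mul]
    congr 2
    rw [Real.sqrt_eq_rpow, Real.rpow_def_of_pos (by positivity)]
    congr 1; ring
  exact hgr.uniformlyHyperbolic (div_pos (Real.log_pos (by nlinarith)) two_pos)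

end

/-! ### Steerable families -/

section
variable {k : ℕ}

/-- A family is steerable if there are a compact set `D` of matrices and two distinct words of the
same length such that every product in `D`, continued by either of the two words, can be continued
further, by a word of a fixed length, to return to the interior of `D`. -/
def Steerable (A : Fin k → SL(2, ℝ)) : Prop :=
  ∃ (s : Bool → List (Fin k)) (q ℓ : ℕ) (D : Set SL(2, ℝ)), (∀ b, (s b).length = q) ∧
    s false ≠ s true ∧ IsCompact D ∧ D.Nonempty ∧
    ∀ M ∈ D, ∀ b, ∃ v : List (Fin k), v.length + q = ℓ ∧ wordProd A (s b ++ v) * M ∈ interior D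

lemma isOpen_setOf_steerable : IsOpen {A : Fin k → SL(2, ℝ) | Steerable A} := by
  rw [isOpen_iff_mem_nhds]
  rintro A ⟨s, q, ℓ, D, hs, hne, hD, hD0, h⟩
  have : ∀ᶠ B in 𝓝 A, ∀ M ∈ D, ∀ b, ∃ v : List (Fin k), v.length + q = ℓ ∧
      wordProd B (s b ++ v) * M ∈ interior D := by
    refine hD.eventually_forall_of_forall_eventually fun M hM => ?_
    rw [eventually_all]
    intro b
    obtain ⟨v, hv, hvM⟩ := h M hM b
    have hc : Continuous fun p : (Fin k → SL(2, ℝ)) × SL(2, ℝ) =>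
        wordProd p.1 (s b ++ v) * p.2 :=
      ((continuous_wordProd _).comp continuous_fst).mul continuous_snd
    filter_upwards [hc.tendsto (A, M) (isOpen_interior.mem_nhds hvM)] with p hp
    exact ⟨v, hv, hp⟩
  filter_upwards [this] with B hB
  exact ⟨s, q, ℓ, D, hs, hne, hD, hD0, hB⟩

/-- The rotation by the angle `α`. -/
noncomputable def rot (α : ℝ) : SL(2, ℝ) :=
  ⟨!![Real.cos α, -Real.sin α; Real.sin α, Real.cos α], by
    rw [Matrix.det_fin_two_of]; nlinarith [Real.sin_sq_add_cos_sq α]⟩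

lemma coe_rot (α : ℝ) : (rot α : Matrix (Fin 2) (Fin 2) ℝ) =
    !![Real.cos α, -Real.sin α; Real.sin α, Real.cos α] := rfl

lemma rot_pow (α : ℝ) (n : ℕ) : rot α ^ n = rot (n * α) := by
  induction n with
  | zero => ext i j; fin_cases i <;> fin_cases j <;> simp [coe_rot]
  | succ n ih =>
    rw [pow_succ, ih]
    have e : ((n + 1 : ℕ) : ℝ) * α = n * α + α := by push_cast; ring
    rw [e]
    ext i j
    fin_cases i <;> fin_cases j <;>
      simp [coe_rot, Real.cos_add, Real.sin_add] <;> ring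

/-- An elliptic matrix is conjugate to a rotation. -/
lemma exists_conj_rot {M : SL(2, ℝ)} (h : |tr M| < 2) :
    ∃ (g : SL(2, ℝ)) (α : ℝ), g⁻¹ * M * g = rot α ∧ tr M = 2 * Real.cos α := by
  have hdet := det_eq_one M
  have ht : tr M = M 0 0 + M 1 1 := rfl
  set t := tr M
  have ht2 : t ^ 2 < 4 := by nlinarith [sq_abs t, abs_nonneg t]
  have hc : M 1 0 ≠ 0 := by
    intro hc
    rw [hc, mul_zero, sub_zero] at hdet
    rw [ht] at ht2
    nlinarith [sq_nonneg (M 0 0 - M 1 1)]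
  -- The sign of the angle is that of the lower left entry.
  obtain ⟨α, hcos, hpos⟩ : ∃ α, Real.cos α = t / 2 ∧ 0 < Real.sin α / M 1 0 := by
    have hs : 0 < Real.sin (Real.arccos (t / 2)) := by
      rw [Real.sin_arccos]; apply Real.sqrt_pos.mpr; nlinarith
    obtain ⟨h1, h2⟩ := abs_lt.mp h
    have hcos : Real.cos (Real.arccos (t / 2)) = t / 2 :=
      Real.cos_arccos (by linarith) (by linarith)
    rcases hc.lt_or_gt with hc | hc
    · exact ⟨-Real.arccos (t / 2), by rw [Real.cos_neg, hcos],
        by rw [Real.sin_neg]; exact div_pos_of_neg_of_neg (by linarith) hc⟩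
    · exact ⟨Real.arccos (t / 2), hcos, div_pos hs hc⟩
  have hsc := Real.sin_sq_add_cos_sq α
  set y := Real.sin α / M 1 0 with hy
  set x := (M 0 0 - M 1 1) / (2 * M 1 0) with hx
  have hyr : Real.sqrt y ^ 2 = y := Real.sq_sqrt hpos.le
  have hyr0 : Real.sqrt y ≠ 0 := by positivity
  set r := Real.sqrt y
  let g : SL(2, ℝ) := ⟨!![r, x / r; 0, 1 / r], by
    rw [Matrix.det_fin_two_of]; field_simp; ring⟩
  have hg : (g : Matrix (Fin 2) (Fin 2) ℝ) = !![r, x / r; 0, 1 / r] := rfl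
  have e1 : Real.sin α = M 1 0 * y := by rw [hy]; field_simp
  have e2 : M 1 0 * x + M 1 1 = t / 2 := by rw [hx, ht]; field_simp; ring
  have e3 : M 0 0 - M 1 0 * x = t / 2 := by rw [hx, ht]; field_simp; ring
  have e4 : M 1 0 * x ^ 2 + M 0 1 + M 1 0 * y ^ 2 = 0 := by
    have : M 1 0 * (M 1 0 * x ^ 2 + M 0 1 + M 1 0 * y ^ 2) = 0 := by
      have h5 : (M 1 0 * y) ^ 2 = 1 - (t / 2) ^ 2 := by rw [← e1, ← hcos]; linarith
      have h6 : M 1 0 * x = (M 0 0 - M 1 1) / 2 := by rw [hx]; field_simp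
      have h7 : (M 1 0 * x) ^ 2 = ((M 0 0 - M 1 1) / 2) ^ 2 := by rw [h6]
      rw [ht] at h5
      linear_combination h5 + h7 - hdet
    exact (mul_eq_zero.mp this).resolve_left hc
  refine ⟨g, α, ?_, by rw [hcos]; ring⟩
  rw [mul_assoc, inv_mul_eq_iff_eq_mul]
  ext i j
  fin_cases i <;> fin_cases j
  · simp [hg, coe_rot, Matrix.mul_apply, Fin.sum_univ_two, hcos]
    field_simp
    rw [hyr, e1]
    linear_combination (2 * y) * e3
  · simp [hg, coe_rot, Matrix.mul_apply, Fin.sum_univ_two, hcos]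
    field_simp
    rw [hyr, e1]
    linear_combination (2 * x) * e3 + 2 * e4
  · simp [hg, coe_rot, Matrix.mul_apply, Fin.sum_univ_two, hcos]
    field_simp
    rw [hyr, e1]
  · simp [hg, coe_rot, Matrix.mul_apply, Fin.sum_univ_two, hcos]
    field_simp
    linear_combination 2 * e2

/-- The square of the Frobenius norm, a function of the displacement of the base point of the
hyperbolic plane. -/
def frob (M : SL(2, ℝ)) : ℝ := M 0 0 ^ 2 + M 0 1 ^ 2 + M 1 0 ^ 2 + M 1 1 ^ 2

lemma frob_nonneg (M : SL(2, ℝ)) : 0 ≤ frob M := by unfold frob; positivity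

lemma two_le_frob (M : SL(2, ℝ)) : 2 ≤ frob M := by
  unfold frob
  nlinarith [det_eq_one M, sq_nonneg (M 0 0 - M 1 1), sq_nonneg (M 0 1 + M 1 0)]

lemma continuous_frob : Continuous frob := by
  unfold frob
  have h00 := continuous_coe_apply 0 0
  have h01 := continuous_coe_apply 0 1
  have h10 := continuous_coe_apply 1 0
  have h11 := continuous_coe_apply 1 1
  fun_prop

lemma frob_mul_le (M N : SL(2, ℝ)) : frob (M * N) ≤ frob M * frob N := by
  simp only [frob, Matrix.SpecialLinearGroup.coe_mul, Matrix.mul_apply, Fin.sum_univ_two]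
  nlinarith [sq_nonneg (M 0 0 * N 1 0 - M 0 1 * N 0 0), sq_nonneg (M 0 0 * N 1 1 - M 0 1 * N 0 1),
    sq_nonneg (M 1 0 * N 1 0 - M 1 1 * N 0 0), sq_nonneg (M 1 0 * N 1 1 - M 1 1 * N 0 1)]

lemma frob_rot_mul (α : ℝ) (M : SL(2, ℝ)) : frob (rot α * M) = frob M := by
  simp [frob, coe_rot, Matrix.mul_apply, Fin.sum_univ_two]
  linear_combination (M 0 0 ^ 2 + M 0 1 ^ 2 + M 1 0 ^ 2 + M 1 1 ^ 2) * Real.sin_sq_add_cos_sq α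

lemma isCompact_setOf_frob_le (R : ℝ) : IsCompact {M : SL(2, ℝ) | frob M ≤ R} := by
  have hbox : IsCompact {M : Matrix (Fin 2) (Fin 2) ℝ |
      ∀ i j, M i j ∈ Set.Icc (-(R + 1)) (R + 1)} := by
    have := isCompact_univ_pi (X := fun _ : Fin 2 => Fin 2 → ℝ) fun _ : Fin 2 =>
      isCompact_univ_pi (X := fun _ : Fin 2 => ℝ) fun _ : Fin 2 =>
        (isCompact_Icc : IsCompact (Set.Icc (-(R + 1)) (R + 1)))
    convert! this using 1
    ext M
    exact ⟨fun h i _ j _ => h i j, fun h i j => h i trivial j trivial⟩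
  refine (Matrix.SpecialLinearGroup.isClosedEmbedding_val.isCompact_preimage
    hbox).of_isClosed_subset
    (isClosed_le continuous_frob continuous_const) fun (M : SL(2, ℝ)) hM i j => ?_
  have hM : frob M ≤ R := hM
  have h1 : M i j ^ 2 ≤ R := by
    refine le_trans ?_ hM
    unfold frob
    fin_cases i <;> fin_cases j <;> simp <;> nlinarith [sq_nonneg (M 0 0), sq_nonneg (M 0 1),
      sq_nonneg (M 1 0), sq_nonneg (M 1 1)]
  have h2 : |M i j| ≤ R + 1 := by
    have := abs_nonneg (M i j)
    nlinarith [sq_abs (M i j)]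
  exact abs_le.mp h2

/-- The multiples of an irrational angle are uniformly dense. -/
lemma exists_cos_le {α : ℝ} (hα : Irrational (α / Real.pi)) {η : ℝ} (hη : 0 < η) :
    ∃ m₀ : ℕ, ∀ ζ : ℂ, ∃ m ≤ m₀,
      ζ.re * Real.cos (2 * (m * α)) - ζ.im * Real.sin (2 * (m * α)) ≤ -(1 - η) * ‖ζ‖ := by
  have hdense := dense_addSubgroupClosure_pair_iff.mpr hα
  have hopen : ∀ m : ℤ, IsOpen {ψ : ℝ | Real.cos (ψ + 2 * (m * α)) < -(1 - η)} := fun m =>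
    isOpen_lt (by fun_prop) continuous_const
  have hcover : ∀ ψ : ℝ, ∃ m : ℤ, Real.cos (ψ + 2 * (m * α)) < -(1 - η) := by
    intro ψ
    obtain ⟨x, hx, hxm⟩ := hdense.inter_open_nonempty {x | Real.cos (ψ + 2 * x) < -(1 - η)}
      (isOpen_lt (by fun_prop) continuous_const) ⟨(Real.pi - ψ) / 2, by
        change Real.cos _ < _
        rw [show ψ + 2 * ((Real.pi - ψ) / 2) = Real.pi by ring, Real.cos_pi]; linarith⟩
    obtain ⟨m, n, rfl⟩ := AddSubgroup.mem_closure_pair.mp hxm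
    refine ⟨m, ?_⟩
    have hx : Real.cos (ψ + 2 * (m • α + n • Real.pi)) < -(1 - η) := hx
    rw [zsmul_eq_mul, zsmul_eq_mul,
      show ψ + 2 * (m * α + n * Real.pi) = ψ + 2 * (m * α) + n * (2 * Real.pi) by ring,
      Real.cos_add_int_mul_two_pi] at hx
    exact hx
  obtain ⟨T, hT⟩ := (isCompact_Icc (a := -Real.pi) (b := Real.pi)).elim_finite_subcover _ hopen
    fun ψ _ => Set.mem_iUnion.mpr (hcover ψ)
  -- Integer multiples bounded by `N` suffice; a rotation of `ζ` makes them nonnegative.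
  obtain ⟨N, hN⟩ : ∃ N : ℕ, ∀ m ∈ T, -(N : ℤ) ≤ m ∧ m ≤ N := by
    refine ⟨∑ m ∈ T, m.natAbs, fun m hm => ?_⟩
    have := Finset.single_le_sum (f := fun m : ℤ => m.natAbs) (fun _ _ => Nat.zero_le _) hm
    omega
  refine ⟨2 * N, fun ζ => ?_⟩
  set ξ : ℂ := ζ * Complex.exp ((2 * (N * α) : ℝ) * Complex.I) with hξ
  have hnorm : ‖ξ‖ = ‖ζ‖ := by rw [hξ, norm_mul, Complex.norm_exp_ofReal_mul_I, mul_one]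
  obtain ⟨m, hmT, hm⟩ : ∃ m ∈ T, Real.cos (ξ.arg + 2 * (m * α)) < -(1 - η) := by
    simpa using hT ⟨(Complex.neg_pi_lt_arg ξ).le, Complex.arg_le_pi ξ⟩
  obtain ⟨j, hj⟩ : ∃ j : ℕ, (j : ℤ) = m + N := ⟨(m + N).toNat, by have := hN m hmT; omega⟩
  refine ⟨j, by have := hN m hmT; omega, ?_⟩
  have hjr : (j : ℝ) = m + N := by exact_mod_cast hj
  have e1 : ζ.re * Real.cos (2 * (j * α)) - ζ.im * Real.sin (2 * (j * α)) =
      (ζ * Complex.exp ((2 * (j * α) : ℝ) * Complex.I)).re := by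
    rw [Complex.mul_re, Complex.exp_ofReal_mul_I_re, Complex.exp_ofReal_mul_I_im]
  have e2 : ζ * Complex.exp ((2 * (j * α) : ℝ) * Complex.I) =
      ‖ξ‖ * Complex.exp ((ξ.arg + 2 * (m * α) : ℝ) * Complex.I) := by
    have h1 : ζ * Complex.exp ((2 * (j * α) : ℝ) * Complex.I) =
        ξ * Complex.exp ((2 * (m * α) : ℝ) * Complex.I) := by
      rw [hξ, mul_assoc, ← Complex.exp_add, hjr]; congr 2; push_cast; ring
    rw [h1]
    conv_lhs => rw [← Complex.norm_mul_exp_arg_mul_I ξ]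
    rw [mul_assoc, ← Complex.exp_add]; congr 2; push_cast; ring
  rw [e1, e2, Complex.re_ofReal_mul, Complex.exp_ofReal_mul_I_re, hnorm, mul_comm]
  exact mul_le_mul_of_nonneg_right hm.le (norm_nonneg _)

/-- The law of cosines of the hyperbolic plane, in terms of Frobenius norms: rotating the second
factor changes the norm of a product by a sinusoid. -/
lemma exists_frob_mul_rot_mul (P X : SL(2, ℝ)) : ∃ ζ : ℂ,
    ‖ζ‖ = Real.sqrt (frob P ^ 2 / 4 - 1) * Real.sqrt (frob X ^ 2 / 4 - 1) ∧
    ∀ φ : ℝ, frob (P * rot φ * X) = frob P * frob X / 2 +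
      2 * (ζ.re * Real.cos (2 * φ) - ζ.im * Real.sin (2 * φ)) := by
  set a := (P 0 0 ^ 2 + P 1 0 ^ 2 - P 0 1 ^ 2 - P 1 1 ^ 2) / 2 with ha
  set b := P 0 0 * P 0 1 + P 1 0 * P 1 1 with hb
  set c := (X 0 0 ^ 2 + X 0 1 ^ 2 - X 1 0 ^ 2 - X 1 1 ^ 2) / 2 with hc
  set d := X 0 0 * X 1 0 + X 0 1 * X 1 1 with hd
  have hP : frob P ^ 2 / 4 - 1 = a ^ 2 + b ^ 2 := by
    rw [ha, hb, frob]
    linear_combination (P 0 0 * P 1 1 - P 0 1 * P 1 0 + 1) * det_eq_one P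
  have hX : frob X ^ 2 / 4 - 1 = c ^ 2 + d ^ 2 := by
    rw [hc, hd, frob]
    linear_combination (X 0 0 * X 1 1 - X 0 1 * X 1 0 + 1) * det_eq_one X
  refine ⟨⟨a * c + b * d, a * d - b * c⟩, ?_, fun φ => ?_⟩
  · rw [hP, hX, ← Real.sqrt_mul (by positivity), Complex.norm_def, Complex.normSq_apply]
    congr 1; simp only; ring
  · have h2c : Real.cos (2 * φ) = Real.cos φ ^ 2 - Real.sin φ ^ 2 := by rw [Real.cos_two_mul']
    have h2s := Real.sin_two_mul φ
    simp only [h2c, h2s]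
    have h1 := Real.sin_sq_add_cos_sq φ
    rw [ha, hb, hc, hd]
    simp [frob, coe_rot, Matrix.mul_apply, Fin.sum_univ_two]
    linear_combination ((P 0 0 ^ 2 + P 0 1 ^ 2 + P 1 0 ^ 2 + P 1 1 ^ 2) *
      (X 0 0 ^ 2 + X 0 1 ^ 2 + X 1 0 ^ 2 + X 1 1 ^ 2) / 2) * h1

end

/-! ### Steering by an irrational rotation -/

section
variable {k : ℕ}

/-- If `P` moves the base point of the hyperbolic plane, then a suitable iterate of an irrational
rotation, inserted between `P` and `X`, makes `P` undo part of the displacement by `X`. -/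
lemma exists_frob_contraction {α : ℝ} (hα : Irrational (α / Real.pi)) {P : SL(2, ℝ)}
    (hP : 2 < frob P) : ∃ (κ C : ℝ) (m₀ : ℕ), 0 ≤ κ ∧ κ < 1 ∧ 0 ≤ C ∧
      ∀ X : SL(2, ℝ), ∃ m ≤ m₀, frob (P * rot α ^ m * X) ≤ κ * frob X + C := by
  set p := frob P with hp
  have hh : Real.sqrt (p ^ 2 / 4 - 1) ^ 2 = p ^ 2 / 4 - 1 := Real.sq_sqrt (by nlinarith)
  have hh0 : 0 < Real.sqrt (p ^ 2 / 4 - 1) := Real.sqrt_pos.mpr (by nlinarith)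
  set h := Real.sqrt (p ^ 2 / 4 - 1)
  have hκpos : 0 < p / 2 - h := by nlinarith
  have hκ1 : p / 2 - h < 1 := by nlinarith
  set η := min 1 ((1 - (p / 2 - h)) / (2 * h)) with hη
  have hη0 : 0 < η := lt_min one_pos (div_pos (by linarith) (by linarith))
  have hη1 : η ≤ 1 := min_le_left _ _
  have hηh : η * h ≤ (1 - (p / 2 - h)) / 2 := by
    have : η * (2 * h) ≤ 1 - (p / 2 - h) := (le_div_iff₀ (by linarith)).mp (min_le_right _ _)
    linarith
  obtain ⟨m₀, hm₀⟩ := exists_cos_le hα hη0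
  refine ⟨p / 2 - h + η * h, 2 * h, m₀, by positivity, by linarith, by positivity, fun X => ?_⟩
  obtain ⟨ζ, hζ, hfrob⟩ := exists_frob_mul_rot_mul P X
  obtain ⟨m, hm, hle⟩ := hm₀ ζ
  refine ⟨m, hm, ?_⟩
  rw [rot_pow, hfrob, ← hp]
  rw [hζ] at hle
  have hX := two_le_frob X
  have hsq : frob X / 2 - 1 ≤ Real.sqrt (frob X ^ 2 / 4 - 1) :=
    Real.le_sqrt_of_sq_le (by nlinarith)
  have h1 : (1 - η) * (h * (frob X / 2 - 1)) ≤
      (1 - η) * (h * Real.sqrt (frob X ^ 2 / 4 - 1)) := by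
    have : 0 ≤ 1 - η := by linarith
    gcongr
  have h2 : (1 - η) * h ≤ h := by nlinarith
  change _ ≤ -(1 - η) * (h * _) at hle
  nlinarith

lemma length_flatten_replicate (n : ℕ) (w : List (Fin k)) :
    (List.replicate n w).flatten.length = n * w.length := by
  simp

/-- An irrational elliptic product together with a product of the same number of generators that
moves its fixed point in the hyperbolic plane make the family steerable: a large displacement is
reduced by rotating it into the right position and then applying the second product. -/
lemma steerable_of_conj_rot {A : Fin k → SL(2, ℝ)} {w w' : List (Fin k)}
    (hlen : w.length = w'.length) {g : SL(2, ℝ)} {α : ℝ} (hα : Irrational (α / Real.pi))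
    (hw : g⁻¹ * wordProd A w * g = rot α) (hw' : frob (g⁻¹ * wordProd A w' * g) ≠ 2) :
    Steerable A := by
  set P := g⁻¹ * wordProd A w' * g with hP
  have hP2 : 2 < frob P := lt_of_le_of_ne (two_le_frob P) (Ne.symm hw')
  obtain ⟨κ, C, m₀, hκ0, hκ1, hC, hstep⟩ := exists_frob_contraction hα hP2
  set q := w.length with hq
  have hwA : wordProd A w = g * rot α * g⁻¹ := by rw [← hw]; group
  have hwA' : wordProd A w' = g * P * g⁻¹ := by rw [hP]; group
  have hone : ∀ M : SL(2, ℝ), ∃ v : List (Fin k), v.length = (m₀ + 1) * q ∧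
      frob (g⁻¹ * (wordProd A v * M)) ≤ κ * frob (g⁻¹ * M) + C := by
    intro M
    obtain ⟨m, hm, hle⟩ := hstep (g⁻¹ * M)
    -- Further rotations pad the word to a length independent of `m`.
    refine ⟨(List.replicate m w).flatten ++ (w' ++ (List.replicate (m₀ - m) w).flatten), ?_, ?_⟩
    · simp only [List.length_append, length_flatten_replicate, ← hq, ← hlen]
      rw [show m₀ = m + (m₀ - m) by omega]
      simp only [add_tsub_cancel_left]; ring
    · refine le_trans (le_of_eq ?_) hle
      rw [wordProd_append, wordProd_append, wordProd_flatten_replicate,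
        wordProd_flatten_replicate, hwA, hwA', conj_pow, conj_pow, rot_pow α (m₀ - m)]
      rw [← frob_rot_mul ((m₀ - m : ℕ) * α) (P * rot α ^ m * (g⁻¹ * M))]
      congr 1
      group
  have hiter : ∀ (J : ℕ) (M : SL(2, ℝ)), ∃ v : List (Fin k), v.length = J * ((m₀ + 1) * q) ∧
      frob (g⁻¹ * (wordProd A v * M)) ≤ κ ^ J * frob (g⁻¹ * M) + C / (1 - κ) := by
    intro J
    induction J with
    | zero =>
      intro M
      refine ⟨[], by simp, ?_⟩
      have : 0 ≤ C / (1 - κ) := div_nonneg hC (by linarith)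
      simpa [wordProd] using this
    | succ J ih =>
      intro M
      obtain ⟨v, hv, hvM⟩ := ih M
      obtain ⟨u, hu, huM⟩ := hone (wordProd A v * M)
      refine ⟨v ++ u, by rw [List.length_append, hu, hv]; ring, ?_⟩
      rw [wordProd_append, mul_assoc (wordProd A u)]
      refine huM.trans ?_
      have e : C / (1 - κ) = κ * (C / (1 - κ)) + C := by
        have : 1 - κ ≠ 0 := by linarith
        field_simp; ring
      rw [e, pow_succ]
      nlinarith
  set R := C / (1 - κ) + 2 with hR
  have hCκ : 0 ≤ C / (1 - κ) := div_nonneg hC (by linarith)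
  obtain ⟨J, hJ⟩ : ∃ J : ℕ, κ ^ J * (frob P * R) < 2 := by
    have hpos : 0 < frob P * R := by positivity
    obtain ⟨J, hJ⟩ := exists_pow_lt_of_lt_one (div_pos two_pos hpos) hκ1
    exact ⟨J, (lt_div_iff₀ hpos).mp hJ⟩
  set s : Bool → List (Fin k) := fun b => if b then w' else w with hs
  have hsb : ∀ b M, frob (g⁻¹ * M) ≤ R → frob (g⁻¹ * (wordProd A (s b) * M)) ≤ frob P * R := by
    intro b M hM
    have hMn := frob_nonneg (g⁻¹ * M)
    cases b with
    | false =>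
      have : g⁻¹ * (wordProd A (s false) * M) = rot α * (g⁻¹ * M) := by
        simp only [hs, Bool.false_eq_true, if_false, hwA]; group
      rw [this, frob_rot_mul]
      nlinarith
    | true =>
      have : g⁻¹ * (wordProd A (s true) * M) = P * (g⁻¹ * M) := by
        simp only [hs, if_true, hwA']; group
      rw [this]
      exact (frob_mul_le _ _).trans (by gcongr)
  have hcont : Continuous fun M : SL(2, ℝ) => frob (g⁻¹ * M) :=
    continuous_frob.comp (continuous_const.mul continuous_id)
  refine ⟨s, q, J * ((m₀ + 1) * q) + q, {M | frob (g⁻¹ * M) ≤ R}, ?_, ?_, ?_, ?_, ?_⟩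
  · intro b; cases b <;> simp [hs, hq, ← hlen]
  · intro heq
    simp only [hs, Bool.false_eq_true, if_false, if_true] at heq
    rw [heq, ← hP] at hw
    rw [hw] at hP2
    have := frob_rot_mul α 1
    rw [mul_one] at this
    rw [this] at hP2
    simp [frob] at hP2
    linarith
  · have := (isCompact_setOf_frob_le R).image (continuous_const.mul continuous_id :
      Continuous fun M : SL(2, ℝ) => g * M)
    convert this using 1
    ext M
    constructor
    · exact fun hM => ⟨g⁻¹ * M, hM, by simp⟩
    · rintro ⟨N, hN, rfl⟩
      simpa using hN
  · refine ⟨g, ?_⟩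
    change frob (g⁻¹ * g) ≤ R
    rw [inv_mul_cancel]
    simp [frob]
    linarith
  · intro M hM b
    obtain ⟨v, hv, hvM⟩ := hiter J (wordProd A (s b) * M)
    have hint : {M | frob (g⁻¹ * M) < R} ⊆ interior {M | frob (g⁻¹ * M) ≤ R} :=
      interior_maximal (fun M (hM : frob (g⁻¹ * M) < R) => show frob (g⁻¹ * M) ≤ R from hM.le)
        (isOpen_lt hcont continuous_const)
    refine ⟨v, by rw [hv], hint ?_⟩
    rw [wordProd_append, mul_assoc]
    have h1 := hsb b M hM
    have h2 : κ ^ J * frob (g⁻¹ * (wordProd A (s b) * M)) ≤ κ ^ J * (frob P * R) := by gcongr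
    change frob _ < R
    linarith

lemma eq_of_frob_eq_two {M : SL(2, ℝ)} (h : frob M = 2) : M 1 1 = M 0 0 ∧ M 1 0 = -M 0 1 := by
  have hdet := det_eq_one M
  unfold frob at h
  have h1 : (M 0 0 - M 1 1) ^ 2 + (M 0 1 + M 1 0) ^ 2 = 0 := by nlinarith
  constructor <;> nlinarith [sq_nonneg (M 0 0 - M 1 1), sq_nonneg (M 0 1 + M 1 0)]

lemma norm_act_of_frob_eq_two {M : SL(2, ℝ)} (h : frob M = 2) (v : EuclideanSpace ℝ (Fin 2)) :
    ‖act M v‖ = ‖v‖ := by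
  obtain ⟨h1, h2⟩ := eq_of_frob_eq_two h
  have hdet := det_eq_one M
  rw [h1, h2] at hdet
  rw [← sq_eq_sq₀ (norm_nonneg _) (norm_nonneg _), norm_sq_eq, norm_sq_eq, act_apply_zero,
    act_apply_one, h1, h2]
  linear_combination (v 0 ^ 2 + v 1 ^ 2) * hdet

lemma frob_conj_pow_ne_two_of_hyperbolic {M : SL(2, ℝ)} (h : 2 < |tr M|) (g : SL(2, ℝ)) {q : ℕ}
    (hq : q ≠ 0) : frob (g⁻¹ * M ^ q * g) ≠ 2 := by
  intro h2
  obtain ⟨v, hv, c, hc, hvc⟩ := exists_contracted_eigenvector M (t := |tr M| / 2) (by linarith)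
    (by linarith)
  have hc1 : |c| < 1 := hc.trans_lt (inv_lt_one_of_one_lt₀ (by linarith))
  have hpow : ∀ n : ℕ, act (M ^ n) v = c ^ n • v := by
    intro n
    induction n with
    | zero => simp
    | succ n ih => rw [pow_succ', act_mul, ih, map_smul, hvc, smul_smul, pow_succ]
  have h3 := norm_act_of_frob_eq_two h2 (act g⁻¹ v)
  rw [← act_mul, mul_assoc, mul_assoc, mul_inv_cancel, mul_one, act_mul, hpow, map_smul,
    norm_smul, norm_pow, Real.norm_eq_abs] at h3
  have h4 : 0 < ‖act g⁻¹ v‖ := norm_pos_iff.mpr (act_ne_zero _ (by intro h; simp [h] at hv))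
  have h5 : |c| ^ q < 1 := pow_lt_one₀ (abs_nonneg _) hc1 hq
  nlinarith

/-- The traces of the rotations of finite order, including `2` and `-2`. -/
def rationalTraces : Set ℝ := Set.range fun r : ℚ => 2 * Real.cos (Real.pi * r)

lemma irrational_div_pi {α : ℝ} (h : 2 * Real.cos α ∉ rationalTraces) :
    Irrational (α / Real.pi) := by
  rintro ⟨r, hr⟩
  refine h ⟨r, ?_⟩
  simp only
  rw [hr, mul_div_cancel₀ _ Real.pi_ne_zero]

/-- The upper unipotent matrices. -/
def unipotent (s : ℝ) : SL(2, ℝ) := ⟨!![1, s; 0, 1], by simp⟩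

lemma coe_unipotent (s : ℝ) :
    (unipotent s : Matrix (Fin 2) (Fin 2) ℝ) = !![1, s; 0, 1] := rfl

lemma continuous_unipotent : Continuous unipotent := by
  refine Continuous.subtype_mk (continuous_matrix fun i j => ?_) _
  fin_cases i <;> fin_cases j <;> simp <;> fun_prop

lemma unipotent_zero : unipotent 0 = 1 := by
  ext i j; fin_cases i <;> fin_cases j <;> simp [coe_unipotent]

lemma frob_conj_mul_unipotent_ne_two {g M : SL(2, ℝ)} (h : frob (g⁻¹ * M * g) = 2) {s : ℝ}
    (hs : s ≠ 0) : frob (g⁻¹ * (M * unipotent s) * g) ≠ 2 := by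
  intro h2
  -- The quotient of the two matrices is orthogonal and of trace `2`, hence the identity.
  set N := g⁻¹ * unipotent s * g with hN
  have hNorm : ∀ v, ‖act N v‖ = ‖v‖ := by
    intro v
    rw [← norm_act_of_frob_eq_two h (act N v), ← act_mul, ← norm_act_of_frob_eq_two h2 v]
    congr 2; rw [hN]; group
  have htr : N 0 0 + N 1 1 = 2 := by
    have : tr N = tr (unipotent s) := by
      rw [hN, tr_mul_comm, ← mul_assoc, mul_inv_cancel, one_mul]
    rw [tr, tr, coe_unipotent] at this
    rw [this]; simp; norm_num
  have hcol0 := hNorm (EuclideanSpace.single 0 1)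
  have hcol1 := hNorm (EuclideanSpace.single 1 1)
  rw [← sq_eq_sq₀ (norm_nonneg _) (norm_nonneg _), norm_sq_eq, norm_sq_eq] at hcol0 hcol1
  simp at hcol0 hcol1
  have e00 : N 0 0 = 1 := by
    nlinarith [sq_nonneg (N 0 0 - 1), sq_nonneg (N 1 1 - 1), sq_nonneg (N 0 1), sq_nonneg (N 1 0)]
  have e11 : N 1 1 = 1 := by linarith
  rw [e00] at hcol0
  rw [e11] at hcol1
  have e10 : N 1 0 = 0 := by nlinarith
  have e01 : N 0 1 = 0 := by nlinarith
  have hN1 : N = 1 := by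
    ext i j; fin_cases i <;> fin_cases j <;> simp [e00, e01, e10, e11]
  have hu : unipotent s = 1 := by
    have : unipotent s = g * N * g⁻¹ := by rw [hN]; group
    rw [this, hN1]; group
  apply hs
  have := congrArg (fun M : SL(2, ℝ) => M 0 1) hu
  simpa [coe_unipotent] using this

/-- Families with an elliptic product are limits of steerable families. If a generator `B b` is
hyperbolic, its power of the right length moves the fixed point of any elliptic product. Otherwise
all generators are irrational rotations, and it suffices that two of them have different fixed
points, which can be achieved by perturbing one of them. -/
lemma exists_steerable_mem_of_hasElliptic (hk : 2 ≤ k) {A : Fin k → SL(2, ℝ)} (hA : HasElliptic A)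
    {V : Set (Fin k → SL(2, ℝ))} (hV : IsOpen V) (hAV : A ∈ V) : ∃ B ∈ V, Steerable B := by
  obtain ⟨w, hw⟩ := hA
  -- A small rotation of the generators makes the traces of all products generic.
  obtain ⟨B, hBV, hBw, hgen⟩ : ∃ B ∈ V, |tr (wordProd B w)| < 2 ∧
      ∀ l : List (Fin k), l ≠ [] → tr (wordProd B l) ∉ rationalTraces := by
    have hopen : IsOpen ((fun x => tilt A x) ⁻¹' (V ∩ {B | |tr (wordProd B w)| < 2})) :=
      (hV.inter (isOpen_lt (continuous_tr.comp (continuous_wordProd w)).abs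
        continuous_const)).preimage (continuous_tilt A)
    have hbad : (⋃ l : List (Fin k), ⋃ (_ : l ≠ []), ⋃ c ∈ rationalTraces,
        {x : ℝ | tr (wordProd (tilt A x) l) = c}).Countable :=
      Set.countable_iUnion fun l => Set.countable_iUnion fun hl =>
        (Set.countable_range _).biUnion fun c _ => (finite_setOf_tr_tilt_eq A hl c).countable
    obtain ⟨x, hx, hxb⟩ := (hbad.dense_compl ℝ).inter_open_nonempty _ hopen
      ⟨0, by simpa [tilt_zero] using ⟨hAV, hw⟩⟩
    refine ⟨tilt A x, hx.1, hx.2, fun l hl hmem => hxb ?_⟩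
    simp only [Set.mem_iUnion]
    exact ⟨l, hl, _, hmem, rfl⟩
  have hw0 : w ≠ [] := by
    rintro rfl
    simp [wordProd, tr] at hBw
    norm_num at hBw
  by_cases hhyp : ∃ b, 2 < |tr (B b)|
  · obtain ⟨b, hb⟩ := hhyp
    obtain ⟨g, α, hg, htr⟩ := exists_conj_rot hBw
    refine ⟨B, hBV, steerable_of_conj_rot (w := w) (w' := List.replicate w.length b) (by simp)
      (irrational_div_pi (htr ▸ hgen w hw0)) hg ?_⟩
    rw [wordProd_replicate]
    exact frob_conj_pow_ne_two_of_hyperbolic hb g (by simpa using hw0)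
  · push Not at hhyp
    set a : Fin k := ⟨0, by omega⟩ with ha
    set b : Fin k := ⟨1, by omega⟩ with hb
    have hab : a ≠ b := by simp [ha, hb]
    have hgena : tr (B a) ∉ rationalTraces := by simpa [wordProd] using hgen [a] (by simp)
    have hella : |tr (B a)| < 2 := by
      refine lt_of_le_of_ne (hhyp a) fun heq => hgena ?_
      rcases (abs_eq two_pos.le).mp heq with h | h
      · exact ⟨0, by simp [h]⟩
      · exact ⟨1, by simp [h]⟩
    obtain ⟨g, α, hg, htr⟩ := exists_conj_rot hella
    have hirr := irrational_div_pi (htr ▸ hgena)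
    by_cases hfr : frob (g⁻¹ * B b * g) = 2
    · set F : ℝ → Fin k → SL(2, ℝ) := fun s => Function.update B b (B b * unipotent s) with hF
      have hFc : Continuous F :=
        continuous_const.update b (continuous_const.mul continuous_unipotent)
      have hF0 : F 0 = B := by simp [hF, unipotent_zero]
      have hev : ∀ᶠ s in 𝓝[≠] (0 : ℝ), F s ∈ V :=
        (hFc.tendsto 0).mono_left nhdsWithin_le_nhds (hV.mem_nhds (by rwa [hF0]))
      obtain ⟨s, hsV, hs0⟩ := (hev.and self_mem_nhdsWithin).exists
      refine ⟨F s, hsV, steerable_of_conj_rot (w := [a]) (w' := [b]) rfl (g := g) hirr ?_ ?_⟩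
      · simpa [wordProd, hF, hab] using hg
      · simpa [wordProd, hF] using frob_conj_mul_unipotent_ne_two hfr hs0
    · exact ⟨B, hBV, steerable_of_conj_rot (w := [a]) (w' := [b]) rfl (g := g) hirr
        (by simpa [wordProd] using hg) (by simpa [wordProd] using hfr)⟩

end

/-! ### Random bounded trajectories of a steerable family -/

section
variable {k : ℕ}

lemma opNorm_le_frob (M : SL(2, ℝ)) : opNorm M ≤ frob M := by
  have h2 := two_le_frob M
  refine (act M).opNorm_le_bound (by linarith) fun v => ?_
  rw [← sq_le_sq₀ (norm_nonneg _) (by positivity), mul_pow, norm_sq_eq, norm_sq_eq,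
    act_apply_zero, act_apply_one]
  have h1 : (M 0 0 * v 0 + M 0 1 * v 1) ^ 2 + (M 1 0 * v 0 + M 1 1 * v 1) ^ 2 ≤
      frob M * (v 0 ^ 2 + v 1 ^ 2) := by
    unfold frob
    nlinarith [sq_nonneg (M 0 0 * v 1 - M 0 1 * v 0), sq_nonneg (M 1 0 * v 1 - M 1 1 * v 0)]
  have h3 : frob M * (v 0 ^ 2 + v 1 ^ 2) ≤ frob M ^ 2 * (v 0 ^ 2 + v 1 ^ 2) := by
    have : frob M ≤ frob M ^ 2 := by nlinarith
    gcongr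
  exact h1.trans h3

lemma isLocallyConstant_prodNat (A : Fin k → SL(2, ℝ)) (m : ℤ) (n : ℕ) :
    IsLocallyConstant fun ω : Word k => prodNat A n (shiftPow m ω) := by
  induction n with
  | zero => exact IsLocallyConstant.const _
  | succ n ih =>
    have h : IsLocallyConstant fun ω : Word k => shiftPow m ω n :=
      (IsLocallyConstant.iff_continuous _).mpr (continuous_apply _)
    exact (h.comp A).mul ih

/-- The state reached after `j` decisions `β 0, …, β (j - 1)`. -/
def trajectory {S : Type*} (next : S → Bool → S) (x₀ : S) (β : ℕ → Bool) : ℕ → S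
  | 0 => x₀
  | j + 1 => next (trajectory next x₀ β j) (β j)

lemma isLocallyConstant_trajectory {S : Type*} (next : S → Bool → S) (x₀ : S) (j : ℕ) :
    IsLocallyConstant fun β : ℕ → Bool => trajectory next x₀ β j := by
  induction j with
  | zero => exact IsLocallyConstant.const _
  | succ j ih =>
    have h : IsLocallyConstant fun β : ℕ → Bool => β j :=
      (IsLocallyConstant.iff_continuous _).mpr (continuous_apply j)
    exact ih.comp₂ h next

/-- The word obtained by concatenating blocks of length `ℓ`; `a` is a filler letter. -/
def concat (ℓ : ℕ) (a : Fin k) (blk : ℕ → List (Fin k)) : Word k :=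
  fun i => (blk (i.toNat / ℓ)).getD (i.toNat % ℓ) a

lemma concat_apply {ℓ : ℕ} {a : Fin k} {blk : ℕ → List (Fin k)} {j r : ℕ} (hr : r < ℓ) :
    concat ℓ a blk ((j * ℓ + r : ℕ) : ℤ) = (blk j).getD r a := by
  have h1 : (j * ℓ + r) / ℓ = j := by
    rw [mul_comm, Nat.mul_add_div (by omega), Nat.div_eq_of_lt hr, add_zero]
  have h2 : (j * ℓ + r) % ℓ = r := by
    rw [mul_comm, Nat.mul_add_mod, Nat.mod_eq_of_lt hr]
  simp only [concat, Int.toNat_natCast, h1, h2]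

lemma prodNat_concat {A : Fin k → SL(2, ℝ)} {ℓ : ℕ} {a : Fin k} {blk : ℕ → List (Fin k)}
    (hlen : ∀ j, (blk j).length = ℓ) (j : ℕ) :
    prodNat A ℓ (shiftPow (j * ℓ : ℕ) (concat ℓ a blk)) = wordProd A (blk j) := by
  rw [prodNat_eq_wordProd]
  congr 1
  refine List.ext_getElem (by simp [hlen]) fun r h1 h2 => ?_
  rw [List.getElem_map, List.getElem_range, shiftPow_apply, add_comm]
  have hr : r < ℓ := by simpa using h1
  have := concat_apply (a := a) (blk := blk) (j := j) hr
  push_cast at this ⊢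
  rw [this, List.getD_eq_getElem _ _ (by rwa [hlen])]

lemma opNorm_prodNat_le_pow {A : Fin k → SL(2, ℝ)} {L : ℝ} (hL : ∀ i, opNorm (A i) ≤ L) (n : ℕ)
    (ω : Word k) : opNorm (prodNat A n ω) ≤ L ^ n := by
  induction n with
  | zero =>
    refine (act 1).opNorm_le_bound (by positivity) fun v => by simp
  | succ n ih =>
    rw [prodNat, pow_succ']
    exact (opNorm_mul_le _ _).trans
      (mul_le_mul (hL _) ih (opNorm_nonneg _) ((opNorm_nonneg _).trans (hL (ω n))))

/-- The set of words which read `w` at the positions `a, …, a + n - 1`. -/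
def cyl {n : ℕ} (a : ℕ) (w : Fin n → Fin k) : Set (Word k) :=
  {ω | ∀ j : Fin n, ω ((a + j : ℕ) : ℤ) = w j}

lemma isClopen_cyl {n : ℕ} (a : ℕ) (w : Fin n → Fin k) : IsClopen (cyl a w) := by
  have : cyl a w = ⋂ j : Fin n, (fun ω : Word k => ω ((a + j : ℕ) : ℤ)) ⁻¹' {w j} := by
    ext ω; simp [cyl]
  rw [this]
  exact isClopen_iInter_of_finite fun j => (isClopen_discrete _).preimage (continuous_apply _)

/-- A fair coin. -/
noncomputable def coin : Measure Bool := (PMF.uniformOfFintype Bool).toMeasure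

instance : IsProbabilityMeasure coin := by unfold coin; infer_instance

lemma coin_le {t : Set Bool} (h : t ≠ Set.univ) : coin t ≤ 2⁻¹ := by
  obtain ⟨b, hb⟩ := (Set.ne_univ_iff_exists_notMem t).mp h
  have hsub : t ⊆ {!b} := fun c hc => by
    rw [Set.mem_singleton_iff]
    cases b <;> cases c <;> simp_all
  refine (measure_mono hsub).trans (le_of_eq ?_)
  rw [coin, PMF.toMeasure_apply_singleton _ _ (measurableSet_singleton _)]
  simp

/-- A steerable family carries a random word, with bounded products, each cylinder of length `n`
of which has probability exponentially small in `n`: independent fair decisions determine which of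
the two words comes next, and the return words keep the products in a compact set. -/
theorem Steerable.exists_measure {A : Fin k → SL(2, ℝ)} (hA : Steerable A) :
    ∃ (ℓ : ℕ) (C : ℝ) (ν : Measure (Word k)), 0 < ℓ ∧ IsProbabilityMeasure ν ∧
      (∀ (a n : ℕ) (w : Fin n → Fin k), ν (cyl a w) ≤ 2⁻¹ ^ (n / ℓ - 1)) ∧
      ∀ m n : ℕ, ν {ω | ¬ opNorm (prodNat A n (shiftPow m ω)) ≤ C} = 0 := by
  obtain ⟨s, q, ℓ, D, hs, hne, hD, ⟨M₀, hM₀⟩, hsteer⟩ := hA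
  have hq : 0 < q := by
    rcases Nat.eq_zero_or_pos q with h | h
    · exact absurd ((List.length_eq_zero_iff.mp ((hs false).trans h)).trans
        (List.length_eq_zero_iff.mp ((hs true).trans h)).symm) hne
    · exact h
  have hex : ∀ (M : SL(2, ℝ)) (b : Bool), ∃ v : List (Fin k), M ∈ D →
      v.length + q = ℓ ∧ wordProd A (s b ++ v) * M ∈ D := fun M b => by
    by_cases hM : M ∈ D
    · obtain ⟨v, hv, hvD⟩ := hsteer M hM b
      exact ⟨v, fun _ => ⟨hv, interior_subset hvD⟩⟩
    · exact ⟨[], fun h => absurd h hM⟩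
  choose v hv using hex
  have hqℓ : q ≤ ℓ := by have := (hv M₀ true hM₀).1; omega
  have hℓ : 0 < ℓ := by omega
  obtain ⟨a₀⟩ : Nonempty (Fin k) := ⟨(s true).get ⟨0, by rw [hs]; exact hq⟩⟩
  set st : (ℕ → Bool) → ℕ → SL(2, ℝ) :=
    trajectory (fun M b => wordProd A (s b ++ v M b) * M) M₀ with hst
  set blk : (ℕ → Bool) → ℕ → List (Fin k) := fun β j => s (β j) ++ v (st β j) (β j) with hblk
  set path : (ℕ → Bool) → Word k := fun β => concat ℓ a₀ (blk β) with hpath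
  have hstD : ∀ β j, st β j ∈ D := by
    intro β j
    induction j with
    | zero => exact hM₀
    | succ j ih => exact (hv _ _ ih).2
  have hlen : ∀ β j, (blk β j).length = ℓ := fun β j => by
    rw [hblk, List.length_append, hs, ← (hv _ (β j) (hstD β j)).1, add_comm]
  have hstate : ∀ β j, prodNat A (j * ℓ) (path β) * M₀ = st β j := by
    intro β j
    induction j with
    | zero => simp [prodNat, hst, trajectory]
    | succ j ih =>
      rw [show (j + 1) * ℓ = ℓ + j * ℓ by ring, prodNat_add, prodNat_concat (hlen β), mul_assoc, ih]
      rfl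
  -- The products are bounded because all states are.
  obtain ⟨L, hL⟩ : ∃ L, ∀ i, opNorm (A i) ≤ max L 1 :=
    ⟨∑ i, opNorm (A i), fun i => le_max_of_le_left (Finset.single_le_sum
      (f := fun i => opNorm (A i)) (fun _ _ => opNorm_nonneg _) (Finset.mem_univ i))⟩
  have hL1 := le_max_right L 1
  set L' := max L 1
  obtain ⟨R, hR⟩ := hD.bddAbove_image continuous_frob.continuousOn
  have hRD : ∀ M ∈ D, opNorm M ≤ R := fun M hM =>
    (opNorm_le_frob M).trans (hR ⟨M, hM, rfl⟩)
  have hR0 : 0 ≤ R := (opNorm_nonneg M₀).trans (hRD M₀ hM₀)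
  have hX : ∀ β n, opNorm (prodNat A n (path β) * M₀) ≤ L' ^ ℓ * R := by
    intro β n
    have e : n = n % ℓ + n / ℓ * ℓ := by rw [mul_comm]; exact (Nat.mod_add_div n ℓ).symm
    rw [e, prodNat_add, mul_assoc, hstate]
    refine (opNorm_mul_le _ _).trans (mul_le_mul ?_ (hRD _ (hstD _ _)) (opNorm_nonneg _)
      (by positivity))
    exact (opNorm_prodNat_le_pow hL _ _).trans
      (pow_le_pow_right₀ hL1 (Nat.mod_lt _ hℓ).le)
  have hbound : ∀ β (m n : ℕ),
      opNorm (prodNat A n (shiftPow m (path β))) ≤ (L' ^ ℓ * R) * (L' ^ ℓ * R) := by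
    intro β m n
    have e : prodNat A n (shiftPow m (path β)) =
        (prodNat A (n + m) (path β) * M₀) * (prodNat A m (path β) * M₀)⁻¹ := by
      rw [prodNat_add]; group
    rw [e]
    refine (opNorm_mul_le _ _).trans ?_
    rw [opNorm_inv]
    exact mul_le_mul (hX _ _) (hX _ _) (opNorm_nonneg _) (by positivity)
  have hcont : Continuous path := by
    refine continuous_pi fun i => ?_
    have h1 : IsLocallyConstant fun β : ℕ → Bool => β (i.toNat / ℓ) :=
      (IsLocallyConstant.iff_continuous _).mpr (continuous_apply _)
    exact ((isLocallyConstant_trajectory (fun M b => wordProd A (s b ++ v M b) * M) M₀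
      (i.toNat / ℓ)).comp₂ h1
        fun M b => (s b ++ v M b).getD (i.toNat % ℓ) a₀).continuous
  refine ⟨ℓ, (L' ^ ℓ * R) * (L' ^ ℓ * R), (Measure.infinitePi fun _ : ℕ => coin).map path, hℓ,
    Measure.isProbabilityMeasure_map hcont.measurable.aemeasurable, ?_, ?_⟩
  · intro a n w
    rw [Measure.map_apply hcont.measurable (isClopen_cyl a w).isOpen.measurableSet]
    -- Each block inside the window determines a decision.
    set S := Finset.Ico (a / ℓ + 1) (a / ℓ + 1 + (n / ℓ - 1)) with hS
    set t : ℕ → Set Bool := fun j => {b | ∀ r < q, ∀ i : Fin n, a + i = j * ℓ + r →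
      (s b).getD r a₀ = w i} with ht
    have hsub : path ⁻¹' cyl a w ⊆ Set.pi S t := by
      intro β hβ j _ r hr i hi
      have h1 : concat ℓ a₀ (blk β) ((a + i : ℕ) : ℤ) = w i := hβ i
      rw [hi, concat_apply (by omega), hblk] at h1
      rw [← h1, List.getD_append _ _ _ _ (by rw [hs]; exact hr)]
    refine (measure_mono hsub).trans ?_
    rw [Measure.infinitePi_pi (fun _ : ℕ => coin) fun _ _ => MeasurableSet.of_discrete]
    refine (Finset.prod_le_pow_card S _ 2⁻¹ fun j hj => coin_le ?_).trans (by rw [hS]; simp)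
    intro huniv
    rw [hS, Finset.mem_Ico] at hj
    apply hne
    have e1 : a < j * ℓ := by
      have h1 := Nat.lt_div_mul_add (a := a) hℓ
      have h2 := Nat.mul_le_mul_right ℓ hj.1
      rw [add_mul, one_mul] at h2
      omega
    have e2 : (j + 1) * ℓ ≤ a + n := by
      have h1 : j + 1 ≤ a / ℓ + n / ℓ := by omega
      have h2 := Nat.mul_le_mul_right ℓ h1
      have h3 := Nat.div_mul_le_self a ℓ
      have h4 := Nat.div_mul_le_self n ℓ
      rw [add_mul (a / ℓ)] at h2
      omega
    rw [add_mul, one_mul] at e2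
    refine List.ext_getElem ((hs _).trans (hs _).symm) fun r h1 h2 => ?_
    rw [hs] at h1
    have hmem : ∀ b, b ∈ t j := fun b => huniv ▸ Set.mem_univ b
    have hi : j * ℓ + r - a < n := by omega
    have h3 := fun b => hmem b r h1 ⟨j * ℓ + r - a, hi⟩ (by simp only; omega)
    have h4 := (h3 false).trans (h3 true).symm
    rwa [List.getD_eq_getElem _ _ (by rw [hs]; exact h1),
      List.getD_eq_getElem _ _ (by rw [hs]; exact h1)] at h4
  · intro m n
    have hm : MeasurableSet {ω : Word k | ¬ opNorm (prodNat A n (shiftPow m ω)) ≤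
        (L' ^ ℓ * R) * (L' ^ ℓ * R)} :=
      (isLocallyConstant_prodNat A m n
        {M | ¬ opNorm M ≤ (L' ^ ℓ * R) * (L' ^ ℓ * R)}).measurableSet
    rw [Measure.map_apply hcont.measurable hm]
    convert measure_empty (μ := Measure.infinitePi fun _ : ℕ => coin)
    ext β
    simpa using hbound β m n

end

/-! ### An invariant measure -/

section

/-- The Krylov–Bogoliubov argument, keeping track of bounds for clopen sets that hold along the
whole forward orbit of the initial measure. -/
theorem exists_invariant_measure {X : Type*} [TopologicalSpace X] [CompactSpace X]
    [TopologicalSpace.MetrizableSpace X] [MeasurableSpace X] [BorelSpace X] {T : X → X}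
    (hT : Continuous T) (ν : Measure X) [IsProbabilityMeasure ν] :
    ∃ μ : Measure X, IsProbabilityMeasure μ ∧ MeasurePreserving T μ μ ∧
      ∀ (G : Set X) (c : ENNReal), IsClopen G → (∀ i : ℕ, ν (T^[i] ⁻¹' G) ≤ c) → μ G ≤ c := by
  have hTi : ∀ i : ℕ, Continuous T^[i] := fun i => hT.iterate i
  have hprob : ∀ i : ℕ, IsProbabilityMeasure (ν.map T^[i]) := fun i =>
    Measure.isProbabilityMeasure_map (hTi i).measurable.aemeasurable
  set m : ℕ → Measure X := fun n =>
    ((n + 1 : ℕ) : ENNReal)⁻¹ • ∑ i ∈ Finset.range (n + 1), ν.map T^[i] with hm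
  have hn0 : ∀ n : ℕ, ((n + 1 : ℕ) : ENNReal) ≠ 0 := fun n => by positivity
  have hnt : ∀ n : ℕ, ((n + 1 : ℕ) : ENNReal) ≠ ⊤ := fun n => ENNReal.natCast_ne_top _
  have hmp : ∀ n, IsProbabilityMeasure (m n) := fun n => ⟨by
    simp only [hm, Measure.smul_apply, Measure.coe_finsetSum, Finset.sum_apply, measure_univ,
      Finset.sum_const, Finset.card_range, nsmul_eq_mul, mul_one, smul_eq_mul]
    exact ENNReal.inv_mul_cancel (hn0 n) (hnt n)⟩
  set M : ℕ → ProbabilityMeasure X := fun n => ⟨m n, hmp n⟩ with hM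
  -- A limit point of the averages along the orbit.
  set U : Ultrafilter ℕ := Ultrafilter.of atTop
  have hU : (U : Filter ℕ) ≤ atTop := Ultrafilter.of_le _
  obtain ⟨μ, -, hμ⟩ := isCompact_univ.ultrafilter_le_nhds (U.map M) (by simp)
  have hlim : Tendsto M U (𝓝 μ) := hμ
  refine ⟨μ, inferInstance, ⟨hT.measurable, ?_⟩, fun G c hG h => ?_⟩
  · have : IsProbabilityMeasure ((μ : Measure X).map T) :=
      Measure.isProbabilityMeasure_map hT.measurable.aemeasurable
    refine ext_of_forall_integral_eq_of_IsFiniteMeasure fun f => ?_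
    rw [integral_map hT.measurable.aemeasurable f.continuous.aestronglyMeasurable]
    set g : BoundedContinuousFunction X ℝ := f.compContinuous ⟨T, hT⟩
    have h1 := (ProbabilityMeasure.tendsto_iff_forall_integral_tendsto.mp hlim) f
    have h2 := (ProbabilityMeasure.tendsto_iff_forall_integral_tendsto.mp hlim) g
    have hint : ∀ (φ : BoundedContinuousFunction X ℝ) (n : ℕ), ∫ x, φ x ∂(m n) =
        ((n + 1 : ℕ) : ℝ)⁻¹ * ∑ i ∈ Finset.range (n + 1), ∫ x, φ (T^[i] x) ∂ν := fun φ n => by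
      simp only [hm]
      rw [integral_smul_measure, integral_finsetSum_measure fun i _ => by
        have := hprob i; exact φ.integrable _]
      simp only [ENNReal.toReal_inv, ENNReal.toReal_natCast, smul_eq_mul]
      congr 1
      refine Finset.sum_congr rfl fun i _ => ?_
      rw [integral_map (hTi i).measurable.aemeasurable φ.continuous.aestronglyMeasurable]
    have hdiff : ∀ n, |∫ x, g x ∂(m n) - ∫ x, f x ∂(m n)| ≤ 2 * ‖f‖ / ((n : ℝ) + 1) := by
      intro n
      have hg : ∀ i, ∫ x, g (T^[i] x) ∂ν = ∫ x, f (T^[i + 1] x) ∂ν := fun i => by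
        simp only [Function.iterate_succ_apply']; rfl
      have hb : ∀ i, |∫ x, f (T^[i] x) ∂ν| ≤ ‖f‖ := fun i => by
        have := norm_integral_le_of_norm_le_const (μ := ν) (f := fun x => f (T^[i] x))
          (ae_of_all _ fun x => f.norm_coe_le_norm _)
        simpa using this
      rw [hint, hint, ← mul_sub, ← Finset.sum_sub_distrib]
      simp only [hg]
      rw [Finset.sum_range_sub (fun i => ∫ x, f (T^[i] x) ∂ν), abs_mul, abs_inv, div_eq_inv_mul]
      push_cast
      rw [abs_of_pos (by positivity : (0 : ℝ) < (n : ℝ) + 1)]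
      refine mul_le_mul_of_nonneg_left ?_ (by positivity)
      have h3 := hb (n + 1)
      have h4 := hb 0
      have h5 := abs_sub (∫ x, f (T^[n + 1] x) ∂ν) (∫ x, f (T^[0] x) ∂ν)
      linarith
    have hzero : Tendsto (fun n => ∫ x, g x ∂(m n) - ∫ x, f x ∂(m n)) U (𝓝 0) := by
      refine squeeze_zero_norm hdiff (Tendsto.mono_left ?_ hU)
      exact Tendsto.div_atTop tendsto_const_nhds
        (tendsto_atTop_add_const_right _ _ tendsto_natCast_atTop_atTop)
    exact sub_eq_zero.mp (tendsto_nhds_unique (h2.sub h1) hzero)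
  · have h1 := ProbabilityMeasure.tendsto_measure_of_null_frontier_of_tendsto' hlim
      (E := G) (by simp [hG.frontier_eq])
    refine le_of_tendsto h1 (Eventually.of_forall fun n => ?_)
    simp only [hM, hm, ProbabilityMeasure.coe_mk, Measure.smul_apply, Measure.coe_finsetSum,
      Finset.sum_apply, smul_eq_mul]
    have h2 : ∑ i ∈ Finset.range (n + 1), (ν.map T^[i]) G ≤ ((n + 1 : ℕ) : ENNReal) * c := by
      refine (Finset.sum_le_card_nsmul _ _ c fun i _ => ?_).trans (by simp)
      rw [Measure.map_apply (hTi i).measurable hG.isOpen.measurableSet]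
      exact h i
    calc _ ≤ ((n + 1 : ℕ) : ENNReal)⁻¹ * (((n + 1 : ℕ) : ENNReal) * c) := by gcongr
      _ = c := by rw [← mul_assoc, ENNReal.inv_mul_cancel (hn0 n) (hnt n), one_mul]

variable {k : ℕ}

lemma continuous_shiftPow (m : ℤ) : Continuous (shiftPow m : Word k → Word k) :=
  continuous_pi fun _ => continuous_apply _

/-- The set of the words all of whose products are bounded by `C`. -/
def boundedWords (A : Fin k → SL(2, ℝ)) (C : ℝ) : Set (Word k) :=
  {ω | ∀ (m : ℤ) (n : ℕ), opNorm (prodNat A n (shiftPow m ω)) ≤ C}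

lemma boundedWords_eq_iInter (A : Fin k → SL(2, ℝ)) (C : ℝ) : boundedWords A C =
    ⋂ (m : ℤ) (n : ℕ), {ω | opNorm (prodNat A n (shiftPow m ω)) ≤ C} := by
  ext ω; simp [boundedWords]

lemma isClopen_opNorm_le (A : Fin k → SL(2, ℝ)) (C : ℝ) (m : ℤ) (n : ℕ) :
    IsClopen {ω : Word k | opNorm (prodNat A n (shiftPow m ω)) ≤ C} :=
  ⟨⟨isLocallyConstant_prodNat A m n {M | ¬ opNorm M ≤ C}⟩,
    isLocallyConstant_prodNat A m n {M | opNorm M ≤ C}⟩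

lemma isCompact_boundedWords (A : Fin k → SL(2, ℝ)) (C : ℝ) : IsCompact (boundedWords A C) := by
  rw [boundedWords_eq_iInter]
  exact (isClosed_iInter fun m => isClosed_iInter fun n => (isClopen_opNorm_le A C m n).1).isCompact

lemma shiftPow_mem_boundedWords {A : Fin k → SL(2, ℝ)} {C : ℝ} {ω : Word k}
    (h : ω ∈ boundedWords A C) (j : ℤ) : shiftPow j ω ∈ boundedWords A C := fun m n => by
  rw [← shiftPow_add]; exact h _ _

lemma shift_image_boundedWords (A : Fin k → SL(2, ℝ)) (C : ℝ) :
    shift '' boundedWords A C = boundedWords A C := by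
  ext ω
  constructor
  · rintro ⟨η, hη, rfl⟩
    exact shiftPow_mem_boundedWords hη 1
  · intro hω
    refine ⟨shiftPow (-1) ω, shiftPow_mem_boundedWords hω (-1), ?_⟩
    rw [shift, ← shiftPow_add]; simp

lemma opNorm_prodInt_le {A : Fin k → SL(2, ℝ)} {C : ℝ} {ω : Word k} (h : ω ∈ boundedWords A C)
    (n : ℤ) : opNorm (prodInt A n ω) ≤ C := by
  cases n with
  | ofNat n => simpa [prodInt] using h 0 n
  | negSucc n => simpa only [prodInt, opNorm_inv] using h _ _

/-- A steerable family carries an invariant measure, supported on words with bounded products,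
which gives exponentially small mass to cylinders. -/
theorem Steerable.exists_invariant_measure {A : Fin k → SL(2, ℝ)} (hA : Steerable A) :
    ∃ (ℓ : ℕ) (C : ℝ) (μ : Measure (Word k)), 0 < ℓ ∧ IsProbabilityMeasure μ ∧
      MeasurePreserving shift μ μ ∧
      (∀ (n : ℕ) (w : Fin n → Fin k), μ (cyl 0 w) ≤ 2⁻¹ ^ (n / ℓ - 1)) ∧
      μ (boundedWords A C)ᶜ = 0 := by
  obtain ⟨ℓ, C, ν, hℓ, hν, hcyl, hbdd⟩ := hA.exists_measure
  obtain ⟨μ, hμ, hinv, hle⟩ := OneStep.exists_invariant_measure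
    (continuous_shiftPow (k := k) 1) ν
  refine ⟨ℓ, C, μ, hℓ, hμ, hinv, fun n w => ?_, ?_⟩
  · refine hle _ _ (isClopen_cyl 0 w) fun i => ?_
    convert hcyl i n w using 2
    ext ω
    change (∀ _, _) ↔ (∀ _, _)
    refine forall_congr' fun j => ?_
    change shift^[i] ω _ = _ ↔ _
    rw [shift_iterate, shiftPow_apply]
    congr! 2
    push_cast; ring
  · have hzero : ∀ (m : ℕ) (n : ℕ), μ {ω | opNorm (prodNat A n (shiftPow m ω)) ≤ C}ᶜ = 0 := by
      intro m n
      refine le_antisymm (hle _ _ (isClopen_opNorm_le A C m n).compl fun i => ?_) zero_le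
      refine (le_of_eq ?_).trans (hbdd (m + i) n).le
      congr 1
      ext ω
      change ¬ opNorm (prodNat A n (shiftPow m (shift^[i] ω))) ≤ C ↔ _
      rw [shift_iterate, ← shiftPow_add]
      push_cast; rfl
    rw [boundedWords_eq_iInter, Set.compl_iInter, measure_iUnion_null_iff]
    intro m
    rw [Set.compl_iInter, measure_iUnion_null_iff]
    intro n
    obtain ⟨m, rfl | rfl⟩ := m.eq_nat_or_neg
    · exact hzero m n
    · -- Negative times reduce to nonnegative ones by invariance.
      rw [← (hinv.iterate m).measure_preimage
        (isClopen_opNorm_le A C (-m) n).compl.isOpen.measurableSet.nullMeasurableSet]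
      refine Eq.trans ?_ (hzero 0 n)
      congr 1
      ext ω
      change ¬ opNorm (prodNat A n (shiftPow (-m) (shift^[m] ω))) ≤ C ↔ _
      rw [shift_iterate, ← shiftPow_add]
      simp

end

/-! ### Positive entropy -/

section
variable {k : ℕ}

/-- The measure gives cylinders exponentially small mass, halved with each `ℓ` further letters. The
division and the subtraction in the exponent are those of natural numbers, so that nothing is said
about cylinders of length less than `2 ℓ`. -/
def ThinCylinders (μ : Measure (Word k)) (ℓ : ℕ) : Prop :=
  ∀ (n : ℕ) (w : Fin n → Fin k), μ (cyl 0 w) ≤ 2⁻¹ ^ (n / ℓ - 1)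

lemma log_two_mul_le {ℓ n : ℕ} (hℓ : 0 < ℓ) (hn : 4 * ℓ ≤ n) :
    Real.log 2 / (2 * ℓ) * n ≤ (n / ℓ - 1 : ℕ) * Real.log 2 := by
  have h1 : 1 ≤ n / ℓ := (Nat.one_le_div_iff hℓ).mpr (by omega)
  have hℓr : (0 : ℝ) < ℓ := by exact_mod_cast hℓ
  have h2 : (n : ℝ) / ℓ < (n / ℓ : ℕ) + 1 := by
    rw [div_lt_iff₀ hℓr]
    have := Nat.lt_div_mul_add (a := n) hℓ
    have h3 : n < (n / ℓ + 1) * ℓ := by rw [add_mul, one_mul]; exact this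
    exact_mod_cast h3
  have h4 : 4 ≤ (n : ℝ) / ℓ := by
    rw [le_div_iff₀ hℓr]; exact_mod_cast hn
  rw [Nat.cast_sub h1]
  have h5 : Real.log 2 / (2 * ℓ) * n = (n / ℓ) / 2 * Real.log 2 := by field_simp
  rw [h5]
  have := Real.log_pos one_lt_two
  gcongr
  push_cast
  linarith

lemma itinerary_preimage (n : ℕ) (w : Fin n → Fin k) :
    itinerary shift (fun ω : Word k => ω 0) n ⁻¹' {w} = cyl 0 w := by
  ext ω
  rw [Set.mem_preimage, Set.mem_singleton_iff, funext_iff]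
  refine forall_congr' fun j => ?_
  rw [itinerary, shift_iterate, shiftPow_apply]
  simp

lemma ThinCylinders.metricEntropy_pos {μ : Measure (Word k)} [IsProbabilityMeasure μ] {ℓ : ℕ}
    (hℓ : 0 < ℓ) (h : ThinCylinders μ ℓ) : 0 < metricEntropy μ shift := by
  set f : Word k → Fin k := fun ω => ω 0 with hf
  have hfm : Measurable f := measurable_pi_apply 0
  have hpos : 0 < Real.log 2 / (2 * ℓ) :=
    div_pos (Real.log_pos one_lt_two) (by positivity)
  have hjoin : ∀ n : ℕ, (n / ℓ - 1 : ℕ) * Real.log 2 ≤ joinEntropy μ shift f n := by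
    intro n
    have hsum : ∑ w : Fin n → Fin k, μ.real (cyl 0 w) = 1 := by
      have hm : Measurable (itinerary shift f n) := by
        refine measurable_pi_lambda _ fun j => ?_
        exact hfm.comp ((continuous_shiftPow 1).iterate j).measurable
      have := sum_measureReal_preimage_singleton (μ := μ) (f := itinerary shift f n) Finset.univ
        fun w _ => hm (measurableSet_singleton w)
      simpa [hf, itinerary_preimage] using this
    have hterm : ∀ w : Fin n → Fin k, μ.real (cyl 0 w) * ((n / ℓ - 1 : ℕ) * Real.log 2) ≤
        Real.negMulLog (μ.real (cyl 0 w)) := by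
      intro w
      rcases (measureReal_nonneg (μ := μ) (s := cyl 0 w)).eq_or_lt with h0 | h0
      · rw [← h0]; simp
      · have h1 : μ.real (cyl 0 w) ≤ 2⁻¹ ^ (n / ℓ - 1) := by
          have := ENNReal.toReal_mono (by simp) (h n w)
          simpa [Measure.real] using this
        have h2 := Real.log_le_log h0 h1
        rw [Real.log_pow, Real.log_inv] at h2
        rw [Real.negMulLog]
        nlinarith
    calc _ = ∑ w : Fin n → Fin k, μ.real (cyl 0 w) * ((n / ℓ - 1 : ℕ) * Real.log 2) := by
          rw [← Finset.sum_mul, hsum, one_mul]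
      _ ≤ _ := by
          rw [joinEntropy]
          simp only [hf, itinerary_preimage]
          exact Finset.sum_le_sum fun w _ => hterm w
  have hlim : ((Real.log 2 / (2 * ℓ) : ℝ) : EReal) ≤
      limsup (fun n : ℕ => ((joinEntropy μ shift f n / n : ℝ) : EReal)) atTop := by
    rw [← limsup_const (f := (atTop : Filter ℕ)) ((Real.log 2 / (2 * ℓ) : ℝ) : EReal)]
    refine limsup_le_limsup ?_
    filter_upwards [eventually_ge_atTop (4 * ℓ)] with n hn
    rw [EReal.coe_le_coe_iff, le_div_iff₀ (by exact_mod_cast (by omega : 0 < n))]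
    exact (log_two_mul_le hℓ hn).trans (hjoin n)
  refine lt_of_lt_of_le (EReal.coe_pos.mpr hpos) (hlim.trans ?_)
  rw [metricEntropy]
  exact le_iSup_of_le k (le_iSup₂_of_le f hfm le_rfl)

lemma ThinCylinders.topologicalEntropy_pos {μ : Measure (Word k)} [IsProbabilityMeasure μ] {ℓ : ℕ}
    (hℓ : 0 < ℓ) (h : ThinCylinders μ ℓ) {K : Set (Word k)} (hK : μ Kᶜ = 0) :
    0 < topologicalEntropy K := by
  let _ : UniformSpace (Word k) := @Pi.uniformSpace ℤ (fun _ => Fin k) (fun _ => ⊥)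
  have hpos : 0 < Real.log 2 / (2 * ℓ) :=
    div_pos (Real.log_pos one_lt_two) (by positivity)
  set V : SetRel (Word k) (Word k) := {p | p.1 0 = p.2 0} with hV
  have hVu : V ∈ uniformity (Word k) := by
    let _ : UniformSpace (Fin k) := ⊥
    have : UniformContinuous fun ω : Word k => ω 0 := Pi.uniformContinuous_proj (fun _ => Fin k) 0
    exact this (show {p : Fin k × Fin k | p.1 = p.2} ∈
      𝓟 (SetRel.id : SetRel (Fin k) (Fin k)) from fun p hp => hp)
  -- A dynamical cover meets enough cylinders to carry the whole mass.
  have hcard : ∀ n : ℕ, ((2 ^ (n / ℓ - 1) : ℕ) : ℕ∞) ≤ Dynamics.coverMincard shift K V n := by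
    intro n
    refine le_iInf₂ fun s hs => ?_
    have hsub : K ⊆ ⋃ x ∈ s, cyl 0 fun j : Fin n => x (j : ℕ) := by
      intro y hy
      obtain ⟨x, hx, hxy⟩ := hs hy
      refine Set.mem_iUnion₂.mpr ⟨x, hx, fun j => ?_⟩
      have h1 : shift^[(j : ℕ)] y 0 = shift^[(j : ℕ)] x 0 :=
        Dynamics.mem_dynEntourage.mp hxy j j.2
      simpa [shift_iterate, shiftPow_apply] using h1
    have hone : 1 ≤ μ K := by
      have := measure_union_le (μ := μ) K Kᶜ
      rwa [Set.union_compl_self, measure_univ, hK, add_zero] at this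
    have hle : (1 : ENNReal) ≤ s.card * 2⁻¹ ^ (n / ℓ - 1) := by
      refine hone.trans ((measure_mono hsub).trans ((measure_biUnion_finset_le s _).trans ?_))
      refine (Finset.sum_le_card_nsmul _ _ _ fun x _ => h n _).trans (by simp)
    have hle2 : ((2 ^ (n / ℓ - 1) : ℕ) : ENNReal) ≤ (s.card : ENNReal) := by
      calc ((2 ^ (n / ℓ - 1) : ℕ) : ENNReal) = 2 ^ (n / ℓ - 1) * 1 := by push_cast; ring
        _ ≤ 2 ^ (n / ℓ - 1) * (s.card * 2⁻¹ ^ (n / ℓ - 1)) := by gcongr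
        _ = s.card * (2 * 2⁻¹) ^ (n / ℓ - 1) := by rw [mul_pow]; ring
        _ = s.card := by rw [ENNReal.mul_inv_cancel two_ne_zero (by simp)]; simp
    exact_mod_cast hle2
  refine lt_of_lt_of_le (EReal.coe_pos.mpr hpos) (le_trans ?_
    (Dynamics.coverEntropyEntourage_le_coverEntropy shift K hVu))
  refine Frequently.le_expGrowthSup (Eventually.frequently ?_)
  filter_upwards [eventually_ge_atTop (4 * ℓ)] with n hn
  have h1 : ((2 ^ (n / ℓ - 1) : ℕ) : ENNReal) ≤
      ((Dynamics.coverMincard shift K V n : ℕ∞) : ENNReal) := by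
    have := hcard n
    exact_mod_cast ENat.toENNReal_le.mpr this
  refine le_trans ?_ h1
  have e : ((Real.log 2 / (2 * ℓ) : ℝ) : EReal) * (n : EReal) =
      ((Real.log 2 / (2 * ℓ) * n : ℝ) : EReal) := by
    rw [EReal.coe_mul]; rfl
  rw [e, EReal.exp_coe]
  refine (ENNReal.ofReal_le_ofReal (Real.exp_le_exp.mpr (log_two_mul_le hℓ hn))).trans
    (le_of_eq ?_)
  rw [Real.exp_nat_mul, Real.exp_log two_pos, ENNReal.ofReal_pow two_pos.le]
  simp

lemma hasTopExponent_zero {A : Fin k → SL(2, ℝ)} {μ : Measure (Word k)} {C : ℝ}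
    (h : μ (boundedWords A C)ᶜ = 0) : HasTopExponent A μ 0 := by
  refine ⟨0, integrable_zero _ _ _, ?_, by simp⟩
  have hae : ∀ᵐ ω ∂μ, ω ∈ boundedWords A C := by
    rw [ae_iff]; exact h
  filter_upwards [hae] with ω hω
  have h1 : ∀ n : ℕ, 0 ≤ Real.log (opNorm (prodNat A n ω)) := fun n =>
    Real.log_nonneg (one_le_opNorm _)
  have h2 : ∀ n : ℕ, Real.log (opNorm (prodNat A n ω)) ≤ Real.log C := fun n =>
    Real.log_le_log (lt_of_lt_of_le one_pos (one_le_opNorm _)) (by simpa using hω 0 n)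
  refine squeeze_zero (g := fun n : ℕ => 1 / (n : ℝ) * Real.log C)
    (fun n => mul_nonneg (by positivity) (h1 n))
    (fun n => mul_le_mul_of_nonneg_left (h2 n) (by positivity)) ?_
  simpa using (tendsto_one_div_atTop_nhds_zero_nat (𝕜 := ℝ)).mul_const (Real.log C)

lemma not_uniformlyHyperbolic_of_bounded {A : Fin k → SL(2, ℝ)}
    (hb : HasBoundedSetOfPositiveEntropy A) : ¬ UniformlyHyperbolic A := by
  rintro ⟨Eu, Es, hdim, -, c, C, δ, hc, -, hδ, hexp⟩
  obtain ⟨K, -, -, hent, M, hM⟩ := hb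
  obtain ⟨ω, hω⟩ : K.Nonempty := by
    rw [Set.nonempty_iff_ne_empty]
    rintro rfl
    let _ : UniformSpace (Word k) := @Pi.uniformSpace ℤ (fun _ => Fin k) (fun _ => ⊥)
    have hbot : topologicalEntropy (∅ : Set (Word k)) = ⊥ := Dynamics.coverEntropy_empty
    rw [hbot] at hent
    exact absurd hent (by simp)
  obtain ⟨v, hv, hv0⟩ : ∃ v ∈ Eu ω, v ≠ 0 := by
    refine Submodule.exists_mem_ne_zero_of_ne_bot fun h => ?_
    have := (hdim ω).1
    rw [h] at this
    simp at this
  have hv0 : 0 < ‖v‖ := norm_pos_iff.mpr hv0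
  obtain ⟨n, hn⟩ := exists_nat_gt (M / (c * δ))
  rw [div_lt_iff₀ (by positivity)] at hn
  have h1 := (hexp ω n).1 v hv
  have h2 := (norm_act_le (prodNat A n ω) v).trans
    (mul_le_mul_of_nonneg_right (hM ω hω n) hv0.le)
  have h3 := le_of_mul_le_mul_right (h1.trans h2) hv0
  have h4 := Real.add_one_le_exp (δ * n)
  nlinarith

end

end OneStep

theorem theoremC (k : ℕ) (hk : 2 ≤ k) :
    ∃ U : Set (Fin k → SL(2, ℝ)), IsOpen U ∧ Dense U ∧ ∀ A ∈ U,
      Xor (OneStep.UniformlyHyperbolic A) (OneStep.HasBoundedSetOfPositiveEntropy A) ∧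
      (OneStep.HasBoundedSetOfPositiveEntropy A →
        ∃ μ : Measure (OneStep.Word k), IsProbabilityMeasure μ ∧
          MeasurePreserving OneStep.shift μ μ ∧
          0 < OneStep.metricEntropy μ OneStep.shift ∧
          OneStep.HasTopExponent A μ 0) := by
  refine ⟨(closure {A | OneStep.HasElliptic A})ᶜ ∪ {A | OneStep.Steerable A},
    isClosed_closure.isOpen_compl.union OneStep.isOpen_setOf_steerable, ?_, ?_⟩
  · rw [dense_iff_inter_open]
    rintro V hV ⟨A, hA⟩
    by_cases hcl : A ∈ closure {A | OneStep.HasElliptic A}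
    · obtain ⟨B, hBV, hB⟩ := mem_closure_iff.mp hcl V hV hA
      obtain ⟨B', hB'V, hB'⟩ := OneStep.exists_steerable_mem_of_hasElliptic hk hB hV hBV
      exact ⟨B', hB'V, Or.inr hB'⟩
    · exact ⟨A, hA, Or.inl hcl⟩
  · rintro A (hA | hA)
    · have hUH := OneStep.uniformlyHyperbolic_of_notMem_closure A hA
      have hnb : ¬ OneStep.HasBoundedSetOfPositiveEntropy A := fun hb =>
        OneStep.not_uniformlyHyperbolic_of_bounded hb hUH
      exact ⟨Or.inl ⟨hUH, hnb⟩, fun hb => absurd hb hnb⟩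
    · obtain ⟨ℓ, C, μ, hℓ, hμ, hinv, hcyl, hbdd⟩ := OneStep.Steerable.exists_invariant_measure hA
      have hthin : OneStep.ThinCylinders μ ℓ := hcyl
      have hb : OneStep.HasBoundedSetOfPositiveEntropy A :=
        ⟨OneStep.boundedWords A C, OneStep.isCompact_boundedWords A C,
          OneStep.shift_image_boundedWords A C, hthin.topologicalEntropy_pos hℓ hbdd, C,
          fun ω hω n => OneStep.opNorm_prodInt_le hω n⟩
      exact ⟨Or.inr ⟨hb, OneStep.not_uniformlyHyperbolic_of_bounded hb⟩, fun _ =>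
        ⟨μ, hμ, hinv, hthin.metricEntropy_pos hℓ, OneStep.hasTopExponent_zero hbdd⟩⟩
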